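/- Let $Z$ be an invertible complex $n\times n$ matrix. It has a unique factorization $Z=We^{iK}e^{S}$ with $W$ unitary, $K$ real skew-symmetric and $S$ real symmetric (the Mostow decomposition). Put $P_1=e^{iK}$, $P_2=e^S$, and let $\varrho_0(Z)=W$, $\varrho_1(Z)=P_1$, $\varrho_2(Z)=P_2$ define maps $\varrho_0,\varrho_1,\varrho_2$ on the invertible complex $n\times n$ matrices. Let $\|\cdot\|$ be the operator (spectral) norm, $\mathrm{cond}(A)=\|A\|\,\|A^{-1}\|$, and $$\beta(Z)=\int_0^\infty\Big\|e^{-t\left((Z^*Z)^{-1}\overline{Z^*Z}\right)^{1/2}}\Big\|^2dt ,$$ where $\overline{A}$ is the entrywise complex conjugate of $A$ and $M^{1/2}$ denotes the square root of $M$ with positive eigenvalues, which exists and is unique for $M=(Z^*Z)^{-1}\overline{Z^*Z}$; the integral converges. Then $\varrho_0,\varrho_1,\varrho_2$ are (real) differentiable at $Z$, and for every unitarily invariant norm $|||\cdot|||$ on the complex $n\times n$ matrices, with $|||\mathcal T|||=\sup\{|||\mathcal T(X)|||: |||X|||=1\}$ for a real-linear map $\mathcal T$ of this space, one has $$|||D\varrho_0(Z)|||\le\frac{\|P_1^{-1}\|\,\|P_2^{-1}\|}{2}\Big(1+\|P_1\|\,\beta(Z)\,\mathrm{cond}(Z)\,\big(1+\mathrm{cond}(Z)^4\big)\Big),$$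 $$|||D\varrho_1(Z)|||\le\frac{\mathrm{cond}(P_1)\,\|P_2^{-1}\|}{2}\Big(1+\|P_1\|\,\beta(Z)\,\mathrm{cond}(Z)\,\big(1+\mathrm{cond}(Z)^4\big)\Big),$$ $$|||D\varrho_2(Z)|||\le\beta(Z)\,\mathrm{cond}(Z)\,\big(1+\mathrm{cond}(Z)^4\big).$$ -/

import Mathlib

open scoped Matrix Matrix.Norms.L2Operator

/- Throughout, `‖A‖` is the operator (spectral) norm of a complex matrix `A`: the instances opened
above put the norm of operators on Euclidean space on `Matrix (Fin n) (Fin n) ℂ`. -/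

namespace Mostow

noncomputable section

/-- The entrywise complex conjugate of a matrix. -/
def conjMatrix {n : ℕ} (A : Matrix (Fin n) (Fin n) ℂ) : Matrix (Fin n) (Fin n) ℂ :=
  A.map (starRingEnd ℂ)

/-- A real matrix, seen as a complex matrix. -/
def ofRealMatrix {n : ℕ} (A : Matrix (Fin n) (Fin n) ℝ) : Matrix (Fin n) (Fin n) ℂ :=
  A.map (fun x => (x : ℂ))

/-- The condition number of a matrix with respect to the operator norm. -/
def cond {n : ℕ} (A : Matrix (Fin n) (Fin n) ℂ) : ℝ := ‖A‖ * ‖A⁻¹‖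

/-- `N` is a unitarily invariant norm: a norm with `N (U * A * V) = N A` for all unitary `U`, `V`.
(A seminorm is homogeneous, subadditive and nonnegative; definiteness is added here.) -/
structure IsUnitarilyInvariantNorm {n : ℕ} (N : Seminorm ℂ (Matrix (Fin n) (Fin n) ℂ)) :
    Prop where
  definite : ∀ A, N A = 0 → A = 0
  unitary_invariant : ∀ U ∈ Matrix.unitaryGroup (Fin n) ℂ, ∀ V ∈ Matrix.unitaryGroup (Fin n) ℂ,
    ∀ A, N (U * A * V) = N A

/-- The norm of a real-linear map on matrices induced by `N`: the supremum of `N (T X)` over all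
complex matrices `X` with `N X = 1`. The set is bounded above, see `bddAbove_inducedNorm`. -/
def inducedNorm {n : ℕ} (N : Seminorm ℂ (Matrix (Fin n) (Fin n) ℂ))
    (T : Matrix (Fin n) (Fin n) ℂ →L[ℝ] Matrix (Fin n) (Fin n) ℂ) : ℝ :=
  sSup {r : ℝ | ∃ X, N X = 1 ∧ r = N (T X)}

theorem exists_bound {E : Type*} [AddCommGroup E] [Module ℝ E] [FiniteDimensional ℝ E]
    (N : Seminorm ℝ E) (hN : ∀ x, N x = 0 → x = 0) (T : E →ₗ[ℝ] E) :
    ∃ C : ℝ, ∀ x, N (T x) ≤ C * N x := by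
  let _ : NormedAddCommGroup E := AddGroupNorm.toNormedAddCommGroup
    { toFun := N
      map_zero' := map_zero N
      add_le' := map_add_le_add N
      neg' := map_neg_eq_map N
      eq_zero_of_map_eq_zero' := hN }
  let _ : NormedSpace ℝ E := ⟨fun a x => le_of_eq (map_smul_eq_mul N a x)⟩
  exact ⟨‖LinearMap.toContinuousLinearMap T‖, fun x =>
    (LinearMap.toContinuousLinearMap T).le_opNorm x⟩

theorem bddAbove_inducedNorm {n : ℕ} (N : Seminorm ℂ (Matrix (Fin n) (Fin n) ℂ))
    (hN : IsUnitarilyInvariantNorm N)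
    (T : Matrix (Fin n) (Fin n) ℂ →L[ℝ] Matrix (Fin n) (Fin n) ℂ) :
    BddAbove {r : ℝ | ∃ X, N X = 1 ∧ r = N (T X)} := by
  obtain ⟨C, hC⟩ := exists_bound (N.restrictScalars ℝ) hN.definite T.toLinearMap
  refine ⟨C, ?_⟩
  rintro r ⟨X, hX, rfl⟩
  have h : N (T X) ≤ C * N X := hC X
  rwa [hX, mul_one] at h

/-- `Z = W e^{iK} e^S` with `W` unitary, `K` real skew-symmetric and `S` real symmetric. -/
structure IsMostow {n : ℕ} (Z W : Matrix (Fin n) (Fin n) ℂ) (K S : Matrix (Fin n) (Fin n) ℝ) :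
    Prop where
  unitary : W ∈ Matrix.unitaryGroup (Fin n) ℂ
  skew : Kᵀ = -K
  symmetric : Sᵀ = S
  product : Z = W * NormedSpace.exp (Complex.I • ofRealMatrix K) *
    NormedSpace.exp (ofRealMatrix S)

open Classical in
/-- The triple `(W, K, S)` of the Mostow decomposition `Z = W e^{iK} e^S` (a default triple if
there is no such decomposition). -/
def mostowTriple {n : ℕ} (Z : Matrix (Fin n) (Fin n) ℂ) :
    Matrix (Fin n) (Fin n) ℂ × Matrix (Fin n) (Fin n) ℝ × Matrix (Fin n) (Fin n) ℝ :=
  if h : ∃ p : Matrix (Fin n) (Fin n) ℂ × Matrix (Fin n) (Fin n) ℝ × Matrix (Fin n) (Fin n) ℝ,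
      IsMostow Z p.1 p.2.1 p.2.2
  then h.choose else (0, 0, 0)

/-- The unitary factor `W` of the Mostow decomposition. -/
def rho0 {n : ℕ} (Z : Matrix (Fin n) (Fin n) ℂ) : Matrix (Fin n) (Fin n) ℂ :=
  (mostowTriple Z).1

/-- The circular positive definite factor `P₁ = e^{iK}` of the Mostow decomposition. -/
def rho1 {n : ℕ} (Z : Matrix (Fin n) (Fin n) ℂ) : Matrix (Fin n) (Fin n) ℂ :=
  NormedSpace.exp (Complex.I • ofRealMatrix (mostowTriple Z).2.1)

/-- The real positive definite factor `P₂ = e^S` of the Mostow decomposition. -/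
def rho2 {n : ℕ} (Z : Matrix (Fin n) (Fin n) ℂ) : Matrix (Fin n) (Fin n) ℂ :=
  NormedSpace.exp (ofRealMatrix (mostowTriple Z).2.2)

/-- `C` is a square root of `M` all of whose eigenvalues are positive real numbers. -/
def IsPosSqrt {n : ℕ} (M C : Matrix (Fin n) (Fin n) ℂ) : Prop :=
  C * C = M ∧ ∀ z ∈ spectrum ℂ C, 0 < z.re ∧ z.im = 0

open Classical in
/-- The square root `M^{1/2}` with positive eigenvalues (and `0` if there is none). -/
def posSqrt {n : ℕ} (M : Matrix (Fin n) (Fin n) ℂ) : Matrix (Fin n) (Fin n) ℂ :=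
  if h : ∃ C, IsPosSqrt M C then h.choose else 0

/-- The matrix `(Z^* Z)⁻¹ conj(Z^* Z)`. -/
def twistedGram {n : ℕ} (Z : Matrix (Fin n) (Fin n) ℂ) : Matrix (Fin n) (Fin n) ℂ :=
  (Zᴴ * Z)⁻¹ * conjMatrix (Zᴴ * Z)

/-- The function `t ↦ ‖e^{-t ((Z^* Z)⁻¹ conj(Z^* Z))^{1/2}}‖²`. -/
def betaIntegrand {n : ℕ} (Z : Matrix (Fin n) (Fin n) ℂ) (t : ℝ) : ℝ :=
  ‖NormedSpace.exp ((-t) • posSqrt (twistedGram Z))‖ ^ 2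

/-- `β(Z) = ∫₀^∞ ‖e^{-t ((Z^* Z)⁻¹ conj(Z^* Z))^{1/2}}‖² dt`. -/
def beta {n : ℕ} (Z : Matrix (Fin n) (Fin n) ℂ) : ℝ :=
  ∫ t in Set.Ioi (0 : ℝ), betaIntegrand Z t

end

end Mostow

/-! Write `A = Z*Z`, `B = P₂²`, `C = A⁻¹B`, `k = cond Z`. Then `A = P₂P₁²P₂`; conjugation inverts
`P₁` and fixes `P₂`, so `conj A = B A⁻¹ B`. Hence `C² = A⁻¹ conj A`, and `C`, a product of two
positive definite matrices, has positive spectrum. Such square roots are unique, so `Z` determines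
`B`, then `P₂`, `P₁` and `W`. For existence, take `B` to be the geometric mean of `A` and `conj A`,
which is real.

Squaring has derivative `X ↦ CX + XC` at `C`, which is injective when the spectrum of `C` lies in
the right half plane (`sylvester_injective`). So such square roots depend differentiably on the data
(`differentiableAt_of_mul_self`), and the factors are built from `Z` by square roots, products and
inverses.

For the bounds, let primes denote derivatives in direction `X`. Differentiating `AC = B` and `BC =
conj A` and eliminating `C'` gives `C*B' + B'C = conj A' + C*A'C`. Its solution is the integral of
`e^{-tC*} Y e^{-tC}`, where `Y` is the right-hand side, which produces the factor `β`
(`le_of_sylvester`). With `‖C‖ ≤ k`, and with `P₂P₂' + P₂'P₂ = B'` solved the same way, this yields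
`N(P₂') ≤ βk(1 + k²) N(X)`. This beats the asserted bound, and the gap between `k²` and `k⁴` absorbs
the losses for the other factors.

Those are governed by `V = W*XP₂⁻¹ = ΩP₁ + P₁' + P₁P₂'P₂⁻¹`, where `Ω = W*W'` is skew-Hermitian. `V
- V*` gives a Sylvester equation for `Ω`; comparing `P₁V + V*P₁` with its conjugate gives one for
`P₁'`. The remaining terms involve the commutator of `P₂'` with `P₂⁻¹`, bounded by the width of the
spectrum of `P₂⁻¹`, and, for `Ω`, also `P₁ - 1`. Scalar inequalities using `β ≥ 1/2` and `1 ≤ ‖P₁‖ ≤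
k` finish the proof. -/

namespace Mostow

/-! ### Positive definite matrices and positive spectra. -/

section PositiveDefinite

open scoped MatrixOrder ComplexOrder

variable {n : ℕ} {A B P H : Matrix (Fin n) (Fin n) ℂ}

theorem exists_posDef_sqrt (hP : P.PosDef) :
    ∃ S : Matrix (Fin n) (Fin n) ℂ, S.PosDef ∧ S * S = P := by
  have h : CFC.sqrt P * CFC.sqrt P = P :=
    CFC.sqrt_mul_sqrt_self P (Matrix.nonneg_iff_posSemidef.2 hP.posSemidef)
  refine ⟨CFC.sqrt P, ?_, h⟩
  refine ((Matrix.nonneg_iff_posSemidef.1 (CFC.sqrt_nonneg P)).posDef_iff_isUnit).2 ?_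
  have hu : IsUnit (CFC.sqrt P * CFC.sqrt P) := by rw [h]; exact hP.isUnit
  exact isUnit_of_mul_isUnit_left hu

theorem posDef_exp (hH : H.IsHermitian) : (NormedSpace.exp H).PosDef := by
  have h : (0 : Matrix (Fin n) (Fin n) ℂ) ≤ NormedSpace.exp H :=
    IsSelfAdjoint.exp_nonneg hH.isSelfAdjoint
  exact ((Matrix.nonneg_iff_posSemidef.1 h).posDef_iff_isUnit).2 (Matrix.isUnit_exp H)

theorem exists_hermitian_log (hP : P.PosDef) :
    ∃ L : Matrix (Fin n) (Fin n) ℂ, L.IsHermitian ∧ NormedSpace.exp L = P := by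
  have h := (Matrix.isStrictlyPositive_iff_posDef (x := P)).2 hP
  exact ⟨CFC.log P, (IsSelfAdjoint.log (a := P)), CFC.exp_log P h⟩

theorem exp_injective_of_isHermitian (hA : A.IsHermitian) (hB : B.IsHermitian)
    (h : NormedSpace.exp A = NormedSpace.exp B) : A = B := by
  rw [← CFC.log_exp A hA.isSelfAdjoint, ← CFC.log_exp B hB.isSelfAdjoint, h]

theorem posDef_mul_self_of_isHermitian (hH : H.IsHermitian) (hu : IsUnit H) : (H * H).PosDef := by
  have h := Matrix.posSemidef_conjTranspose_mul_self H
  rw [hH.eq] at h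
  exact (h.posDef_iff_isUnit).2 (hu.mul hu)

theorem posDef_conjTranspose_mul_self_of_isUnit (hu : IsUnit A) : (Aᴴ * A).PosDef :=
  ((Matrix.posSemidef_conjTranspose_mul_self A).posDef_iff_isUnit).2
    (((Matrix.isUnit_conjTranspose A).2 hu).mul hu)

theorem posDef_conjugate (hP : P.PosDef) (hH : H.IsHermitian) (hu : IsUnit H) :
    (H * P * H).PosDef := by
  obtain ⟨S, hS, rfl⟩ := exists_posDef_sqrt hP
  have h := posDef_conjTranspose_mul_self_of_isUnit (hS.isUnit.mul hu)
  rw [Matrix.conjTranspose_mul, hH.eq, hS.isHermitian.eq] at h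
  simpa only [mul_assoc] using h

/-- All eigenvalues are positive real numbers. -/
def HasPosSpectrum (M : Matrix (Fin n) (Fin n) ℂ) : Prop :=
  ∀ z ∈ spectrum ℂ M, 0 < z.re ∧ z.im = 0

/-- All eigenvalues lie in the open right half plane. -/
def HasRePosSpectrum (M : Matrix (Fin n) (Fin n) ℂ) : Prop :=
  ∀ z ∈ spectrum ℂ M, 0 < z.re

theorem HasPosSpectrum.rePos (h : HasPosSpectrum A) : HasRePosSpectrum A :=
  fun z hz => (h z hz).1

theorem hasPosSpectrum_of_posDef (hP : P.PosDef) : HasPosSpectrum P := by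
  intro z hz
  rw [hP.isHermitian.spectrum_eq_image_range] at hz
  obtain ⟨_, ⟨i, rfl⟩, rfl⟩ := hz
  simpa using hP.eigenvalues_pos i

theorem HasPosSpectrum.conj (hA : HasPosSpectrum A) {G : Matrix (Fin n) (Fin n) ℂ}
    (hG : IsUnit G) : HasPosSpectrum (G⁻¹ * A * G) := by
  obtain ⟨u, rfl⟩ := hG
  intro z hz
  rw [← Matrix.coe_units_inv, spectrum.units_conjugate'] at hz
  exact hA z hz

/-- With `G = A^{1/2}`, the product equals `G (G B G) G⁻¹`, hence is similar to a positive definite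
matrix. -/
theorem hasPosSpectrum_mul (hA : A.PosDef) (hB : B.PosDef) : HasPosSpectrum (A * B) := by
  obtain ⟨G, hG, rfl⟩ := exists_posDef_sqrt hA
  have h := (hasPosSpectrum_of_posDef (posDef_conjugate hB hG.isHermitian hG.isUnit)).conj
    (Matrix.isUnit_nonsing_inv_iff.2 hG.isUnit)
  have hd := (Matrix.isUnit_iff_isUnit_det _).1 hG.isUnit
  rw [Matrix.nonsing_inv_nonsing_inv _ hd] at h
  have e : G * (G * B * G) * G⁻¹ = G * G * B := by
    rw [mul_assoc, mul_assoc (G * B), Matrix.mul_nonsing_inv _ hd, mul_one, mul_assoc]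
  rwa [e] at h

theorem HasPosSpectrum.isUnit (hA : HasPosSpectrum A) : IsUnit A := by
  by_contra h
  have := hA 0 (spectrum.zero_mem ℂ h)
  simp at this

theorem HasPosSpectrum.inv (hA : HasPosSpectrum A) : HasPosSpectrum A⁻¹ := by
  obtain ⟨u, rfl⟩ := hA.isUnit
  intro z hz
  rw [← Matrix.coe_units_inv] at hz
  have h0 : z ≠ 0 := by
    rintro rfl
    exact (spectrum.zero_notMem_iff ℂ).2 u⁻¹.isUnit hz
  have h := hA z⁻¹ (by
    have := (spectrum.inv_mem_iff (r := Units.mk0 z h0) (a := u⁻¹)).1 hz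
    simpa using this)
  have h2 : z⁻¹.im = 0 ∧ 0 < z⁻¹.re := ⟨h.2, h.1⟩
  have hz' : z = ((z⁻¹.re)⁻¹ : ℝ) := by
    rw [Complex.ofReal_inv, show ((z⁻¹.re : ℝ) : ℂ) = z⁻¹ from Complex.ext rfl (by simp [h2.1]),
      inv_inv]
  rw [hz']
  refine ⟨?_, Complex.ofReal_im _⟩
  rw [Complex.ofReal_re]
  exact inv_pos.2 h2.2

end PositiveDefinite

/-! ### The homogeneous Sylvester equation and uniqueness of square roots. -/

section Sylvester

variable {n : ℕ} {C D X : Matrix (Fin n) (Fin n) ℂ}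

open Polynomial in
-- From `DX = X(-C)` follows `p(D) X = X p(-C)` for every polynomial `p`. For `p` the characteristic
-- polynomial of `D` the left side vanishes by Cayley–Hamilton, while `p(-C)` is invertible because
-- `D` and `-C` share no eigenvalue.
theorem sylvester_injective (hD : HasRePosSpectrum D) (hC : HasRePosSpectrum C)
    (h : D * X + X * C = 0) : X = 0 := by
  have h1 : D * X = X * (-C) := by
    rw [mul_neg]; exact eq_neg_of_add_eq_zero_left h
  have h2 : ∀ p : ℂ[X], aeval D p * X = X * aeval (-C) p := by
    intro p
    induction p using Polynomial.induction_on' with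
    | add p q hp hq => simp [add_mul, mul_add, hp, hq]
    | monomial k a =>
      have hk : D ^ k * X = X * (-C) ^ k := by
        induction k with
        | zero => simp
        | succ k ih => rw [pow_succ, mul_assoc, h1, ← mul_assoc, ih, mul_assoc, ← pow_succ]
      simp only [aeval_monomial, ← Algebra.smul_def, smul_mul_assoc, mul_smul_comm, hk]
  have h3 := h2 D.charpoly
  rw [Matrix.aeval_self_charpoly, zero_mul] at h3
  have hu : IsUnit (aeval (-C) D.charpoly) := by
    by_contra hn
    have h0 := spectrum.zero_mem ℂ hn
    rcases isEmpty_or_nonempty (Fin n) with hn' | hn'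
    · exact hn (isUnit_of_subsingleton _)
    rw [spectrum.map_polynomial_aeval_of_nonempty _ _
      (spectrum.nonempty_of_isAlgClosed_of_finiteDimensional ℂ _)] at h0
    obtain ⟨z, hz, hz0⟩ := h0
    have := hD z ((Matrix.mem_spectrum_iff_isRoot_charpoly).2 hz0)
    rw [← spectrum.neg_eq, Set.mem_neg] at hz
    have := hC _ hz
    simp at this
    linarith
  exact (hu.mul_left_eq_zero).1 h3.symm

/-- `D(D - C) + (D - C)C = D² - C² = 0`, so `D - C` solves the homogeneous equation. -/
theorem rePosSpectrum_sqrt_unique (hD : HasRePosSpectrum D) (hC : HasRePosSpectrum C)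
    (h : D * D = C * C) : D = C := by
  refine sub_eq_zero.1 (sylvester_injective hD hC (X := D - C) ?_)
  rw [mul_sub, sub_mul, h]
  abel

theorem isOpen_hasRePosSpectrum :
    IsOpen {M : Matrix (Fin n) (Fin n) ℂ | HasRePosSpectrum M} := by
  have h := (upperHemicontinuous_spectrum ℂ (Matrix (Fin n) (Fin n) ℂ)).isOpen {z : ℂ | 0 < z.re}
  have e : {M : Matrix (Fin n) (Fin n) ℂ | HasRePosSpectrum M} =
      {M | {z : ℂ | 0 < z.re} ∈ nhdsSet (spectrum ℂ M)} := by
    ext M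
    rw [Set.mem_ofPred_eq, Set.mem_ofPred_eq,
      (isOpen_lt continuous_const Complex.continuous_re).mem_nhdsSet]
    rfl
  rw [e]
  exact h

end Sylvester

/-! ### Differentiability of square roots. -/

section SquareRootDifferentiable

variable {n : ℕ}

open Filter Topology in
-- Inverse function theorem for squaring. No continuity of `g` is assumed: uniqueness of the root
-- identifies `g` with the local inverse applied to `h`.
theorem differentiableAt_of_mul_self {E : Type*} [NormedAddCommGroup E] [NormedSpace ℝ E]
    {g h : E → Matrix (Fin n) (Fin n) ℂ} {x : E} (hg : ∀ᶠ y in 𝓝 x, HasRePosSpectrum (g y))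
    (hgh : ∀ᶠ y in 𝓝 x, g y * g y = h y) (hh : DifferentiableAt ℝ h x) :
    DifferentiableAt ℝ g x := by
  set C := g x with hC
  have hCpos : HasRePosSpectrum C := hg.self_of_nhds
  let T : Matrix (Fin n) (Fin n) ℂ →ₗ[ℝ] Matrix (Fin n) (Fin n) ℂ :=
    LinearMap.mulLeft ℝ C + LinearMap.mulRight ℝ C
  have hT : Function.Injective T := by
    rw [injective_iff_map_eq_zero]
    intro X hX
    exact sylvester_injective hCpos hCpos hX
  let e : Matrix (Fin n) (Fin n) ℂ ≃L[ℝ] Matrix (Fin n) (Fin n) ℂ :=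
    (LinearEquiv.ofInjectiveEndo T hT).toContinuousLinearEquiv
  have hsq : HasStrictFDerivAt (fun M : Matrix (Fin n) (Fin n) ℂ => M * M)
      (e : Matrix (Fin n) (Fin n) ℂ →L[ℝ] Matrix (Fin n) (Fin n) ℂ) C := by
    have h0 := (hasStrictFDerivAt_id (𝕜 := ℝ) C).mul' (hasStrictFDerivAt_id (𝕜 := ℝ) C)
    refine h0.congr_fderiv ?_
    ext1 X
    simp [e, T]
  have hx : h x = C * C := hgh.self_of_nhds.symm
  set φ := hsq.localInverse (fun M : Matrix (Fin n) (Fin n) ℂ => M * M) e C with hφ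
  have hφC : φ (C * C) = C := hsq.localInverse_apply_image
  have hφd : DifferentiableAt ℝ φ (h x) := by
    rw [hx]; exact hsq.to_localInverse.hasFDerivAt.differentiableAt
  have hcomp : DifferentiableAt ℝ (fun y => φ (h y)) x := hφd.comp x hh
  refine hcomp.congr_of_eventuallyEq ?_
  -- The local branch keeps its spectrum in the right half plane near `x`, since that condition is
  -- open.
  have h1 : ∀ᶠ y in 𝓝 x, HasRePosSpectrum (φ (h y)) := by
    apply hcomp.continuousAt.eventually
    beta_reduce
    rw [hx, hφC]
    exact isOpen_hasRePosSpectrum.mem_nhds hCpos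
  have h2 : ∀ᶠ y in 𝓝 x, φ (h y) * φ (h y) = h y := by
    apply hh.continuousAt.eventually (p := fun M => φ M * φ M = M)
    rw [hx]
    exact hsq.eventually_right_inverse
  filter_upwards [hg, hgh, h1, h2] with y a b c d
  exact rePosSpectrum_sqrt_unique a c (b.trans d.symm)

end SquareRootDifferentiable

/-! ### Operator norm estimates from the spectrum of a positive definite matrix. -/

section NormEstimates

open scoped MatrixOrder ComplexOrder

variable {n : ℕ} {P H : Matrix (Fin n) (Fin n) ℂ}

theorem spectrum_le_norm (hP : P.PosDef) {x : ℝ} (hx : x ∈ spectrum ℝ P) : x ≤ ‖P‖ := by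
  have := IsometricContinuousFunctionalCalculus.norm_spectrum_le (𝕜 := ℝ) P hx
    hP.isHermitian.isSelfAdjoint
  exact (le_abs_self x).trans this

theorem spectrum_pos (hP : P.PosDef) {x : ℝ} (hx : x ∈ spectrum ℝ P) : 0 < x := by
  have := hasPosSpectrum_of_posDef hP (algebraMap ℝ ℂ x)
    ((spectrum.algebraMap_mem_iff ℂ).2 hx)
  simpa using this

theorem inv_norm_inv_le_spectrum (hP : P.PosDef) {x : ℝ} (hx : x ∈ spectrum ℝ P) :
    1 ≤ x * ‖P⁻¹‖ := by
  have hx0 := spectrum_pos hP hx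
  obtain ⟨u, hu⟩ := hP.isUnit
  have h : x⁻¹ ∈ spectrum ℝ P⁻¹ := by
    rw [← hu, ← Matrix.coe_units_inv]
    rw [← hu] at hx
    exact (spectrum.inv_mem_iff (r := Units.mk0 x hx0.ne') (a := u)).1 hx
  have := spectrum_le_norm hP.inv h
  rwa [inv_le_iff_one_le_mul₀' hx0] at this

theorem norm_exp_neg_smul_le (hP : P.PosDef) {t : ℝ} (ht : 0 ≤ t) :
    ‖NormedSpace.exp ((-t) • P)‖ ≤ Real.exp (-(‖P⁻¹‖⁻¹ * t)) := by
  have hs : IsSelfAdjoint P := hP.isHermitian.isSelfAdjoint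
  have e : NormedSpace.exp ((-t) • P) = cfc (fun x : ℝ => Real.exp ((-t) * x)) P := by
    rw [cfc_comp_const_mul (-t) Real.exp P]
    exact (CFC.real_exp_eq_normedSpace_exp ((IsSelfAdjoint.all (-t)).smul hs)).symm
  rw [e]
  refine norm_cfc_le (Real.exp_pos _).le fun x hx => ?_
  rw [Real.norm_eq_abs, abs_of_pos (Real.exp_pos _), Real.exp_le_exp]
  have h1 := inv_norm_inv_le_spectrum hP hx
  have h0 := spectrum_pos hP hx
  have h2 : 0 < ‖P⁻¹‖ := by
    by_contra h
    have h3 : ‖P⁻¹‖ = 0 := le_antisymm (not_lt.1 h) (norm_nonneg _)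
    rw [h3] at h1
    linarith
  have h3 : ‖P⁻¹‖⁻¹ ≤ x := (inv_le_iff_one_le_mul₀ h2).2 h1
  nlinarith

theorem norm_sub_algebraMap_le (hP : P.PosDef) {c r : ℝ} (hr : 0 ≤ r)
    (h : ∀ x : ℝ, 0 < x → x ≤ ‖P‖ → 1 ≤ x * ‖P⁻¹‖ → |x - c| ≤ r) :
    ‖P - algebraMap ℝ (Matrix (Fin n) (Fin n) ℂ) c‖ ≤ r := by
  have hs : IsSelfAdjoint P := hP.isHermitian.isSelfAdjoint
  have e : P - algebraMap ℝ (Matrix (Fin n) (Fin n) ℂ) c = cfc (fun x : ℝ => x - c) P := by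
    rw [cfc_sub (fun x : ℝ => x) (fun _ => c) P, cfc_id' ℝ P, cfc_const c P]
  rw [e]
  refine norm_cfc_le hr fun x hx => ?_
  exact h x (spectrum_pos hP hx) (spectrum_le_norm hP hx) (inv_norm_inv_le_spectrum hP hx)

end NormEstimates

/-! ### Ideal property and symmetries of unitarily invariant norms. -/

section UnitarilyInvariant

open scoped MatrixOrder ComplexOrder

variable {n : ℕ} {N : Seminorm ℂ (Matrix (Fin n) (Fin n) ℂ)} {A H X Y : Matrix (Fin n) (Fin n) ℂ}

theorem IsUnitarilyInvariantNorm.unitary_mul (hN : IsUnitarilyInvariantNorm N)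
    {U : Matrix (Fin n) (Fin n) ℂ} (hU : U ∈ Matrix.unitaryGroup (Fin n) ℂ) : N (U * X) = N X := by
  simpa using hN.unitary_invariant U hU 1 (one_mem _) X

theorem IsUnitarilyInvariantNorm.mul_unitary (hN : IsUnitarilyInvariantNorm N)
    {U : Matrix (Fin n) (Fin n) ℂ} (hU : U ∈ Matrix.unitaryGroup (Fin n) ℂ) : N (X * U) = N X := by
  simpa using hN.unitary_invariant 1 (one_mem _) U hU X

theorem seminorm_smul_real (r : ℝ) (hr : 0 ≤ r) : N (r • X) = r * N X := by
  have := map_smul_eq_mul N (r : ℂ) X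
  rw [Complex.norm_real, Real.norm_eq_abs, abs_of_nonneg hr] at this
  rw [← this]
  rfl

/-- A Hermitian contraction is the mean of two unitary matrices. -/
theorem exists_unitary_mean (hH : H.IsHermitian) (h1 : ‖H‖ ≤ 1) :
    ∃ U ∈ Matrix.unitaryGroup (Fin n) ℂ, ∃ V ∈ Matrix.unitaryGroup (Fin n) ℂ,
      (2 : ℝ) • H = U + V := by
  let a : selfAdjoint (Matrix (Fin n) (Fin n) ℂ) := ⟨H, hH.isSelfAdjoint⟩
  let u := selfAdjoint.unitarySelfAddISMul a h1
  refine ⟨u, u.2, star u, Unitary.star_mem u.2, ?_⟩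
  have h := selfAdjoint.realPart_unitarySelfAddISMul a h1
  have h2 : ((realPart (u : Matrix (Fin n) (Fin n) ℂ) : selfAdjoint _) :
      Matrix (Fin n) (Fin n) ℂ) = H := congrArg Subtype.val h
  rw [realPart_apply_coe] at h2
  rw [← h2, smul_smul]
  norm_num

theorem exists_smul_of_norm (hH : H.IsHermitian) (h0 : H ≠ 0) :
    ∃ H' : Matrix (Fin n) (Fin n) ℂ, H'.IsHermitian ∧ ‖H'‖ ≤ 1 ∧ H = ‖H‖ • H' := by
  have hn : ‖H‖ ≠ 0 := norm_ne_zero_iff.2 h0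
  refine ⟨‖H‖⁻¹ • H, ?_, ?_, ?_⟩
  · exact (IsSelfAdjoint.all (‖H‖⁻¹)).smul hH.isSelfAdjoint
  · rw [norm_smul, norm_inv, norm_norm, inv_mul_cancel₀ hn]
  · rw [smul_smul, mul_inv_cancel₀ hn, one_smul]

/-- After scaling, `H` is a mean of two unitaries, each of which preserves `N`. -/
theorem IsUnitarilyInvariantNorm.hermitian_mul_le (hN : IsUnitarilyInvariantNorm N)
    (hH : H.IsHermitian) : N (H * X) ≤ ‖H‖ * N X := by
  by_cases h0 : H = 0
  · simp [h0]
  obtain ⟨H', hH', h1, h2⟩ := exists_smul_of_norm hH h0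
  obtain ⟨U, hU, V, hV, h⟩ := exists_unitary_mean hH' h1
  have key : N (H' * X) ≤ N X := by
    have e : N ((2 : ℝ) • (H' * X)) = 2 * N (H' * X) := seminorm_smul_real 2 (by norm_num)
    rw [← smul_mul_assoc, h, add_mul] at e
    have := map_add_le_add N (U * X) (V * X)
    rw [hN.unitary_mul hU, hN.unitary_mul hV] at this
    linarith
  calc N (H * X) = ‖H‖ * N (H' * X) := by
        rw [← seminorm_smul_real _ (norm_nonneg _), ← smul_mul_assoc, ← h2]
    _ ≤ ‖H‖ * N X := by gcongr

theorem IsUnitarilyInvariantNorm.mul_hermitian_le (hN : IsUnitarilyInvariantNorm N)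
    (hH : H.IsHermitian) : N (X * H) ≤ N X * ‖H‖ := by
  by_cases h0 : H = 0
  · simp [h0]
  obtain ⟨H', hH', h1, h2⟩ := exists_smul_of_norm hH h0
  obtain ⟨U, hU, V, hV, h⟩ := exists_unitary_mean hH' h1
  have key : N (X * H') ≤ N X := by
    have e : N ((2 : ℝ) • (X * H')) = 2 * N (X * H') := seminorm_smul_real 2 (by norm_num)
    rw [← mul_smul_comm, h, mul_add] at e
    have := map_add_le_add N (X * U) (X * V)
    rw [hN.mul_unitary hU, hN.mul_unitary hV] at this
    linarith
  calc N (X * H) = ‖H‖ * N (X * H') := by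
        rw [← seminorm_smul_real _ (norm_nonneg _), ← mul_smul_comm, ← h2]
    _ ≤ N X * ‖H‖ := by rw [mul_comm]; gcongr

theorem norm_unitary_mul {U : Matrix (Fin n) (Fin n) ℂ}
    (hU : U ∈ Matrix.unitaryGroup (Fin n) ℂ) : ‖U * X‖ = ‖X‖ :=
  CStarRing.norm_mem_unitary_mul X hU

/-- The polar decomposition of an invertible matrix. -/
theorem exists_polar (hA : IsUnit A) : ∃ U ∈ Matrix.unitaryGroup (Fin n) ℂ,
    ∃ P : Matrix (Fin n) (Fin n) ℂ, P.PosDef ∧ A = U * P := by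
  obtain ⟨P, hP, h⟩ := exists_posDef_sqrt (posDef_conjTranspose_mul_self_of_isUnit hA)
  have hd := (Matrix.isUnit_iff_isUnit_det _).1 hP.isUnit
  refine ⟨A * P⁻¹, ?_, P, hP, ?_⟩
  · rw [Matrix.mem_unitaryGroup_iff', Matrix.star_eq_conjTranspose, Matrix.conjTranspose_mul,
      hP.inv.isHermitian.eq, mul_assoc, ← mul_assoc Aᴴ, ← h, mul_assoc P,
      Matrix.mul_nonsing_inv _ hd, mul_one, Matrix.nonsing_inv_mul _ hd]
  · rw [mul_assoc, Matrix.nonsing_inv_mul _ hd, mul_one]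

theorem IsUnitarilyInvariantNorm.isUnit_mul_le (hN : IsUnitarilyInvariantNorm N)
    (hA : IsUnit A) : N (A * X) ≤ ‖A‖ * N X := by
  obtain ⟨U, hU, P, hP, rfl⟩ := exists_polar hA
  rw [mul_assoc, hN.unitary_mul hU, norm_unitary_mul hU]
  exact hN.hermitian_mul_le hP.isHermitian

theorem IsUnitarilyInvariantNorm.mul_isUnit_le (hN : IsUnitarilyInvariantNorm N)
    (hA : IsUnit A) : N (X * A) ≤ N X * ‖A‖ := by
  obtain ⟨U, hU, P, hP, h⟩ := exists_polar ((Matrix.isUnit_conjTranspose A).2 hA)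
  have hA' : A = P * Uᴴ := by
    rw [← Matrix.conjTranspose_conjTranspose A, h, Matrix.conjTranspose_mul, hP.isHermitian.eq]
  have hU' : Uᴴ ∈ Matrix.unitaryGroup (Fin n) ℂ := Unitary.star_mem hU
  have hnorm : ‖A‖ = ‖P‖ := by
    rw [hA']; exact CStarRing.norm_mul_mem_unitary P hU'
  rw [hnorm, hA', ← mul_assoc, hN.mul_unitary hU']
  exact hN.mul_hermitian_le hP.isHermitian

/-- The spectrum is finite, so some small shift avoids it. This extends inequalities from invertible
matrices, where the polar decomposition is available, to all matrices. -/
theorem exists_isUnit_add_smul_one (X : Matrix (Fin n) (Fin n) ℂ) {ε : ℝ} (hε : 0 < ε) :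
    ∃ r : ℝ, 0 ≤ r ∧ r ≤ ε ∧ IsUnit (X + r • (1 : Matrix (Fin n) (Fin n) ℂ)) := by
  have hfin : (spectrum ℝ (-X)).Finite := Matrix.finite_real_spectrum
  obtain ⟨r, hr, hr'⟩ := (Set.Ioo_infinite hε).exists_notMem_finite hfin
  refine ⟨r, hr.1.le, hr.2.le, ?_⟩
  rw [spectrum.notMem_iff, Algebra.algebraMap_eq_smul_one, sub_neg_eq_add, add_comm] at hr'
  exact hr'

theorem conjMatrix_mul (X Y : Matrix (Fin n) (Fin n) ℂ) :
    conjMatrix (X * Y) = conjMatrix X * conjMatrix Y := Matrix.map_mul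

/-- An additive map of matrices that does not increase a norm on invertible matrices does not
increase it anywhere. -/
theorem seminorm_le_of_isUnit (T : Matrix (Fin n) (Fin n) ℂ → Matrix (Fin n) (Fin n) ℂ)
    (hadd : ∀ (X : Matrix (Fin n) (Fin n) ℂ) (r : ℝ), T (X + r • 1) = T X + r • 1)
    (h : ∀ X, IsUnit X → N (T X) ≤ N X) (X : Matrix (Fin n) (Fin n) ℂ) : N (T X) ≤ N X := by
  refine le_of_forall_pos_le_add fun δ hδ => ?_
  have h1 : 0 ≤ N 1 := apply_nonneg N 1
  -- The shift enters twice, on each side of the inequality, hence the factor 2; the `+ 1` keeps the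
  -- denominator positive even if `N 1 = 0`.
  obtain ⟨r, hr0, hr, hu⟩ := exists_isUnit_add_smul_one X
    (ε := δ / (2 * (N 1 + 1))) (by positivity)
  have e1 : T X = T (X + r • 1) - r • 1 := by rw [hadd]; abel
  have e2 : N (r • (1 : Matrix (Fin n) (Fin n) ℂ)) = r * N 1 := seminorm_smul_real r hr0
  have h2 := map_sub_le_add N (T (X + r • 1)) (r • 1)
  have h3 := map_add_le_add N X (r • 1)
  have h4 := h _ hu
  rw [← e1] at h2
  rw [e2] at h2 h3
  have h5 : 2 * (r * N 1) ≤ δ := by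
    rw [le_div_iff₀ (by positivity)] at hr
    nlinarith
  linarith

theorem IsUnitarilyInvariantNorm.conjTranspose_le (hN : IsUnitarilyInvariantNorm N)
    (X : Matrix (Fin n) (Fin n) ℂ) : N Xᴴ ≤ N X := by
  refine seminorm_le_of_isUnit (fun X => Xᴴ) (fun X r => ?_) (fun X hX => ?_) X
  · simp
  · obtain ⟨U, hU, P, hP, rfl⟩ := exists_polar hX
    have hU' : Uᴴ ∈ Matrix.unitaryGroup (Fin n) ℂ := Unitary.star_mem hU
    rw [Matrix.conjTranspose_mul, hP.isHermitian.eq, hN.mul_unitary hU', hN.unitary_mul hU]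

theorem conjMatrix_mem_unitaryGroup {U : Matrix (Fin n) (Fin n) ℂ}
    (hU : U ∈ Matrix.unitaryGroup (Fin n) ℂ) : conjMatrix U ∈ Matrix.unitaryGroup (Fin n) ℂ := by
  rw [Matrix.mem_unitaryGroup_iff] at hU ⊢
  have h := congrArg conjMatrix hU
  rw [conjMatrix_mul] at h
  have e1 : conjMatrix (star U) = star (conjMatrix U) := by
    ext i j
    simp [conjMatrix]
  have e2 : conjMatrix (1 : Matrix (Fin n) (Fin n) ℂ) = 1 :=
    Matrix.map_one _ (map_zero _) (map_one _)
  rwa [e1, e2] at h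

/-- A Hermitian matrix is unitarily equivalent to its complex conjugate. -/
theorem exists_unitary_conjMatrix (hH : H.IsHermitian) :
    ∃ U ∈ Matrix.unitaryGroup (Fin n) ℂ, ∃ V ∈ Matrix.unitaryGroup (Fin n) ℂ,
      conjMatrix H = U * H * V := by
  have hV : (hH.eigenvectorUnitary : Matrix (Fin n) (Fin n) ℂ) ∈ Matrix.unitaryGroup (Fin n) ℂ :=
    hH.eigenvectorUnitary.2
  set V := (hH.eigenvectorUnitary : Matrix (Fin n) (Fin n) ℂ)
  have hs : star V ∈ Matrix.unitaryGroup (Fin n) ℂ := Unitary.star_mem hV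
  have h : H = V * Matrix.diagonal (RCLike.ofReal ∘ hH.eigenvalues) * star V := by
    conv_lhs => rw [hH.spectral_theorem, Unitary.conjStarAlgAut_apply]
  have hd : conjMatrix (Matrix.diagonal (RCLike.ofReal ∘ hH.eigenvalues) :
      Matrix (Fin n) (Fin n) ℂ) = Matrix.diagonal (RCLike.ofReal ∘ hH.eigenvalues) := by
    ext i j
    by_cases hij : i = j
    · subst hij; simp [conjMatrix]
    · simp [conjMatrix, hij]
  have h2 : Matrix.diagonal (RCLike.ofReal ∘ hH.eigenvalues) = star V * H * V := by
    have hVV : star V * V = 1 := Matrix.mem_unitaryGroup_iff'.1 hV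
    conv_rhs => rw [h]
    rw [mul_assoc, mul_assoc (V * _), hVV, mul_one, ← mul_assoc, hVV, one_mul]
  refine ⟨conjMatrix V * star V, mul_mem (conjMatrix_mem_unitaryGroup hV) hs,
    V * conjMatrix (star V), mul_mem hV (conjMatrix_mem_unitaryGroup hs), ?_⟩
  conv_lhs => rw [h, conjMatrix_mul, conjMatrix_mul, hd, h2]
  simp only [mul_assoc]

/-- For `X = UP` polar, `conj U` is unitary and `conj P` is unitarily equivalent to `P`, having the
same real eigenvalues. -/
theorem IsUnitarilyInvariantNorm.conjMatrix_le (hN : IsUnitarilyInvariantNorm N)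
    (X : Matrix (Fin n) (Fin n) ℂ) : N (conjMatrix X) ≤ N X := by
  refine seminorm_le_of_isUnit conjMatrix (fun X r => ?_) (fun X hX => ?_) X
  · ext i j
    by_cases hij : i = j
    · subst hij; simp [conjMatrix]
    · simp [conjMatrix, hij]
  · obtain ⟨U, hU, P, hP, rfl⟩ := exists_polar hX
    obtain ⟨U', hU', V', hV', h⟩ := exists_unitary_conjMatrix hP.isHermitian
    rw [conjMatrix_mul, hN.unitary_mul (conjMatrix_mem_unitaryGroup hU), hN.unitary_mul hU, h,
      hN.unitary_invariant _ hU' _ hV']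

end UnitarilyInvariant

/-! ### The integral bound for solutions of Sylvester equations. -/

section SylvesterIntegral

variable {n : ℕ} {N : Seminorm ℂ (Matrix (Fin n) (Fin n) ℂ)} {C D X Y : Matrix (Fin n) (Fin n) ℂ}

/-- Hahn–Banach. Testing against a norming functional turns the integral representation of the
solution into one of real-valued functions. -/
theorem exists_dual_functional (N : Seminorm ℂ (Matrix (Fin n) (Fin n) ℂ))
    (X : Matrix (Fin n) (Fin n) ℂ) :
    ∃ φ : Matrix (Fin n) (Fin n) ℂ →L[ℝ] ℝ, φ X = N X ∧ ∀ Y, φ Y ≤ N Y := by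
  have main : ∃ g : Matrix (Fin n) (Fin n) ℂ →ₗ[ℝ] ℝ, g X = N X ∧ ∀ Y, g Y ≤ N Y := by
    by_cases hX : X = 0
    · exact ⟨0, by simp [hX], fun Y => by simp⟩
    obtain ⟨g, hg1, hg2⟩ := exists_extension_of_le_sublinear
      (LinearPMap.mkSpanSingleton (K := ℝ) X (N X) hX) N
      (fun c hc Y => seminorm_smul_real c hc.le) (map_add_le_add N) (by
        rintro ⟨Y, hY⟩
        obtain ⟨c, rfl⟩ := Submodule.mem_span_singleton.1 hY
        rw [LinearPMap.mkSpanSingleton'_apply, RingHom.id_apply, smul_eq_mul]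
        have h1 : N ((c : ℂ) • X) = ‖(c : ℂ)‖ * N X := map_smul_eq_mul N _ _
        rw [Complex.norm_real, Real.norm_eq_abs] at h1
        have h2 : c * N X ≤ |c| * N X :=
          mul_le_mul_of_nonneg_right (le_abs_self c) (apply_nonneg N X)
        exact h2.trans h1.symm.le)
    refine ⟨g, ?_, hg2⟩
    have := hg1 ⟨X, Submodule.mem_span_singleton_self X⟩
    rw [this]
    exact LinearPMap.mkSpanSingleton_apply ℝ ℝ hX (N X)
  obtain ⟨g, hg1, hg2⟩ := main
  exact ⟨LinearMap.toContinuousLinearMap g, hg1, hg2⟩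

theorem hasDerivAt_exp_neg_smul (C : Matrix (Fin n) (Fin n) ℂ) (t : ℝ) :
    HasDerivAt (fun t : ℝ => NormedSpace.exp ((-t) • C)) (-(NormedSpace.exp ((-t) • C) * C)) t := by
  have h := (hasDerivAt_exp_smul_const (𝕂 := ℝ) C (-t)).scomp t (hasDerivAt_neg t)
  refine HasDerivAt.congr_deriv (f := fun t : ℝ => NormedSpace.exp ((-t) • C)) h ?_
  simp

theorem exp_neg_smul_commute (C : Matrix (Fin n) (Fin n) ℂ) (t : ℝ) :
    NormedSpace.exp ((-t) • C) * C = C * NormedSpace.exp ((-t) • C) :=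
  (((Commute.refl C).smul_left (-t)).exp_left).eq

open Filter Topology MeasureTheory in
/-- The solution of the Sylvester equation `D X + X C = Y` is bounded by means of its
integral representation. -/
theorem IsUnitarilyInvariantNorm.le_of_sylvester (hN : IsUnitarilyInvariantNorm N)
    (h : D * X + X * C = Y) {b : ℝ → ℝ} (hb : IntegrableOn b (Set.Ioi 0))
    (hbound : ∀ t : ℝ, 0 < t →
      ‖NormedSpace.exp ((-t) • D)‖ * ‖NormedSpace.exp ((-t) • C)‖ ≤ b t)
    (hlim : Tendsto (fun t : ℝ => ‖NormedSpace.exp ((-t) • D)‖ * ‖NormedSpace.exp ((-t) • C)‖)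
      atTop (𝓝 0)) :
    N X ≤ (∫ t in Set.Ioi 0, b t) * N Y := by
  obtain ⟨φ, hφX, hφ⟩ := exists_dual_functional N X
  set F : ℝ → Matrix (Fin n) (Fin n) ℂ := fun t =>
    NormedSpace.exp ((-t) • D) * X * NormedSpace.exp ((-t) • C) with hF
  set G : ℝ → Matrix (Fin n) (Fin n) ℂ := fun t =>
    NormedSpace.exp ((-t) • D) * Y * NormedSpace.exp ((-t) • C) with hG
  -- `F` runs from `X` at `0` to `0` at infinity, so integrating `F' = -G` recovers `X`.
  have hFd : ∀ t, HasDerivAt F (-G t) t := by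
    intro t
    have h1 := ((hasDerivAt_exp_neg_smul D t).mul_const X).mul (hasDerivAt_exp_neg_smul C t)
    refine HasDerivAt.congr_deriv (f := F) h1 ?_
    simp only [hG, ← h]
    rw [exp_neg_smul_commute C]
    noncomm_ring
  have hφF : ∀ t ∈ Set.Ici (0 : ℝ), HasDerivAt (fun t => φ (F t)) (-φ (G t)) t := by
    intro t _
    have := φ.hasFDerivAt.comp_hasDerivAt t (hFd t)
    rw [map_neg] at this
    exact this
  have hφG : ∀ t : ℝ, 0 < t → |φ (G t)| ≤ b t * N Y := by
    intro t ht
    have hN' : N (G t) ≤ b t * N Y := by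
      have e1 : N (G t) ≤ N (NormedSpace.exp ((-t) • D) * Y) * ‖NormedSpace.exp ((-t) • C)‖ :=
        hN.mul_isUnit_le (Matrix.isUnit_exp _)
      have e2 : N (NormedSpace.exp ((-t) • D) * Y) ≤ ‖NormedSpace.exp ((-t) • D)‖ * N Y :=
        hN.isUnit_mul_le (Matrix.isUnit_exp _)
      calc N (G t) ≤ ‖NormedSpace.exp ((-t) • D)‖ * N Y * ‖NormedSpace.exp ((-t) • C)‖ := by
            refine e1.trans ?_
            gcongr
        _ = ‖NormedSpace.exp ((-t) • D)‖ * ‖NormedSpace.exp ((-t) • C)‖ * N Y := by ring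
        _ ≤ b t * N Y := by
            have := hbound t ht
            gcongr
    rw [abs_le]
    constructor
    · have := hφ (-G t)
      rw [map_neg, map_neg_eq_map] at this
      linarith
    · exact (hφ _).trans hN'
  have hcont : Continuous fun t => φ (G t) := by
    have hc : ∀ M : Matrix (Fin n) (Fin n) ℂ,
        Continuous fun t : ℝ => NormedSpace.exp ((-t) • M) := fun M =>
      continuous_iff_continuousAt.2 fun t => (hasDerivAt_exp_neg_smul M t).continuousAt
    exact φ.continuous.comp (((hc D).mul continuous_const).mul (hc C))
  have hbY : IntegrableOn (fun t => b t * N Y) (Set.Ioi 0) := hb.mul_const _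
  have hint : IntegrableOn (fun t => -φ (G t)) (Set.Ioi 0) := by
    refine hbY.mono' hcont.neg.aestronglyMeasurable ?_
    filter_upwards [ae_restrict_mem measurableSet_Ioi] with t ht
    rw [norm_neg]
    exact hφG t ht
  have hF0 : Tendsto F atTop (𝓝 0) := by
    refine squeeze_zero_norm (a := fun t => ‖NormedSpace.exp ((-t) • D)‖ *
      ‖NormedSpace.exp ((-t) • C)‖ * ‖X‖) (fun t => ?_) (by simpa using hlim.mul_const ‖X‖)
    calc ‖F t‖ ≤ ‖NormedSpace.exp ((-t) • D)‖ * ‖X‖ * ‖NormedSpace.exp ((-t) • C)‖ :=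
          norm_mul₃_le
      _ = _ := by ring
  have hφ0 : Tendsto (fun t => φ (F t)) atTop (𝓝 0) := by
    have := (φ.continuous.tendsto 0).comp hF0
    rw [map_zero] at this
    exact this
  have hI := integral_Ioi_of_hasDerivAt_of_tendsto' hφF hint hφ0
  have hF00 : F 0 = X := by simp [hF]
  rw [hF00, hφX, integral_neg] at hI
  calc N X = ∫ t in Set.Ioi 0, φ (G t) := by linarith
    _ ≤ ∫ t in Set.Ioi 0, b t * N Y := by
      refine setIntegral_mono_on (by simpa using hint.neg) hbY measurableSet_Ioi fun t ht => ?_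
      exact (le_abs_self _).trans (hφG t ht)
    _ = _ := integral_mul_const _ _

end SylvesterIntegral

/-! ### Existence and uniqueness of the Mostow decomposition via a Riccati equation. -/

section Factorization

open scoped MatrixOrder ComplexOrder

variable {n : ℕ} {Z W A B P P₁ P₂ : Matrix (Fin n) (Fin n) ℂ}

theorem conjMatrix_eq (A : Matrix (Fin n) (Fin n) ℂ) : conjMatrix A = Aᴴᵀ := rfl

theorem conjMatrix_conjMatrix (A : Matrix (Fin n) (Fin n) ℂ) : conjMatrix (conjMatrix A) = A := by
  ext i j; simp [conjMatrix]

theorem conjMatrix_inv (A : Matrix (Fin n) (Fin n) ℂ) : conjMatrix A⁻¹ = (conjMatrix A)⁻¹ := by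
  rw [conjMatrix_eq, Matrix.conjTranspose_nonsing_inv, Matrix.transpose_nonsing_inv]
  rfl

theorem conjMatrix_exp (A : Matrix (Fin n) (Fin n) ℂ) :
    conjMatrix (NormedSpace.exp A) = NormedSpace.exp (conjMatrix A) := by
  rw [conjMatrix_eq, ← Matrix.exp_conjTranspose, ← Matrix.exp_transpose]
  rfl

theorem isHermitian_conjMatrix (hA : A.IsHermitian) : (conjMatrix A).IsHermitian := by
  rw [conjMatrix_eq, hA.eq]
  exact hA.transpose

theorem posDef_conjMatrix (hA : A.PosDef) : (conjMatrix A).PosDef := by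
  rw [conjMatrix_eq, hA.isHermitian.eq]
  exact hA.transpose

theorem posDef_sqrt_unique (hA : A.PosDef) (hB : B.PosDef) (h : A * A = B * B) : A = B :=
  rePosSpectrum_sqrt_unique (hasPosSpectrum_of_posDef hA).rePos (hasPosSpectrum_of_posDef hB).rePos h

theorem isUnit_det_of_posDef (hP : P.PosDef) : IsUnit P.det :=
  (Matrix.isUnit_iff_isUnit_det _).1 hP.isUnit

/-- `B ↦ B A⁻¹ B` is injective on positive definite matrices. -/
theorem riccati_unique {B' : Matrix (Fin n) (Fin n) ℂ} (hA : A.PosDef) (hB : B.PosDef)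
    (hB' : B'.PosDef) (h : B * A⁻¹ * B = B' * A⁻¹ * B') : B = B' := by
  have hu := isUnit_det_of_posDef hA
  have e : A⁻¹ * B = A⁻¹ * B' := by
    refine rePosSpectrum_sqrt_unique (hasPosSpectrum_mul hA.inv hB).rePos
      (hasPosSpectrum_mul hA.inv hB').rePos ?_
    have := congrArg (A⁻¹ * ·) h
    simpa only [mul_assoc] using this
  have := congrArg (A * ·) e
  simpa only [Matrix.mul_nonsing_inv_cancel_left _ _ hu] using this

/-- The geometric mean of a positive definite matrix and its conjugate is real. -/
theorem exists_real_riccati (hA : A.PosDef) :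
    ∃ B : Matrix (Fin n) (Fin n) ℂ, B.PosDef ∧ conjMatrix B = B ∧ B * A⁻¹ * B = conjMatrix A := by
  obtain ⟨G, hG, rfl⟩ := exists_posDef_sqrt hA
  have hu := isUnit_det_of_posDef hG
  have hcA := posDef_conjMatrix hA
  obtain ⟨S, hS, hSS⟩ := exists_posDef_sqrt
    -- With `G = A^{1/2}` and `S = (G⁻¹ conj(A) G⁻¹)^{1/2}`, the geometric mean is `GSG`.
    (posDef_conjugate hcA hG.inv.isHermitian hG.inv.isUnit)
  have hB : (G * S * G).PosDef := posDef_conjugate hS hG.isHermitian hG.isUnit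
  have hric : G * S * G * (G * G)⁻¹ * (G * S * G) = conjMatrix (G * G) := by
    rw [Matrix.mul_inv_rev]
    have e : G * S * G * (G⁻¹ * G⁻¹) * (G * S * G) = G * (S * S) * G := by
      simp only [mul_assoc, Matrix.mul_nonsing_inv_cancel_left _ _ hu,
        Matrix.nonsing_inv_mul_cancel_left _ _ hu]
    rw [e, hSS]
    simp only [mul_assoc, Matrix.mul_nonsing_inv_cancel_left _ _ hu,
      Matrix.nonsing_inv_mul _ hu, mul_one]
  refine ⟨G * S * G, hB, ?_, hric⟩
  set B := G * S * G
  have hcB := posDef_conjMatrix hB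
  have huB := isUnit_det_of_posDef hcB
  refine riccati_unique hA hcB hB ?_
  rw [hric]
  -- Conjugating `B A⁻¹ B = conj A` and solving for `conj A` shows that `conj B` satisfies the same
  -- Riccati equation, so it equals `B`.
  have h1 := congrArg conjMatrix hric
  rw [conjMatrix_conjMatrix, conjMatrix_mul, conjMatrix_mul, conjMatrix_inv] at h1
  have huc := isUnit_det_of_posDef hcA
  conv_lhs => rw [← h1, Matrix.mul_inv_rev, Matrix.mul_inv_rev,
    Matrix.nonsing_inv_nonsing_inv _ huc]
  simp only [mul_assoc, Matrix.mul_nonsing_inv_cancel_left _ _ huB, Matrix.nonsing_inv_mul _ huB,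
    mul_one]

/-- `Z = W P₁ P₂` with `W` unitary, `P₁` circular positive definite, and `P₂` real positive
definite. -/
structure IsMostowFactorization (Z W P₁ P₂ : Matrix (Fin n) (Fin n) ℂ) : Prop where
  unitary : W ∈ Matrix.unitaryGroup (Fin n) ℂ
  posDef_one : P₁.PosDef
  posDef_two : P₂.PosDef
  circular : conjMatrix P₁ = P₁⁻¹
  real : conjMatrix P₂ = P₂
  product : Z = W * P₁ * P₂

/-- `P₂ = B^{1/2}` for the real geometric mean `B`, and `P₁ = (P₂⁻¹AP₂⁻¹)^{1/2}`, the choice that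
makes `ZP₂⁻¹P₁⁻¹` unitary. The Riccati equation says exactly that `conj(P₁²) = P₁⁻²`, and uniqueness
of roots gives circularity. -/
theorem exists_isMostowFactorization (hZ : IsUnit Z) :
    ∃ W P₁ P₂, IsMostowFactorization Z W P₁ P₂ := by
  have hA := posDef_conjTranspose_mul_self_of_isUnit hZ
  obtain ⟨B, hB, hBr, hric⟩ := exists_real_riccati hA
  obtain ⟨P₂, hP₂, rfl⟩ := exists_posDef_sqrt hB
  have h2u := isUnit_det_of_posDef hP₂
  have hAu := isUnit_det_of_posDef hA
  have hreal : conjMatrix P₂ = P₂ := by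
    refine posDef_sqrt_unique (posDef_conjMatrix hP₂) hP₂ ?_
    rw [← conjMatrix_mul, hBr]
  have hR := posDef_conjugate hA hP₂.inv.isHermitian hP₂.inv.isUnit
  obtain ⟨P₁, hP₁, hP₁R⟩ := exists_posDef_sqrt hR
  have h1u := isUnit_det_of_posDef hP₁
  refine ⟨Z * P₂⁻¹ * P₁⁻¹, P₁, P₂, ?_, hP₁, hP₂, ?_, hreal, ?_⟩
  · rw [Matrix.mem_unitaryGroup_iff', Matrix.star_eq_conjTranspose, Matrix.conjTranspose_mul,
      Matrix.conjTranspose_mul, hP₁.inv.isHermitian.eq, hP₂.inv.isHermitian.eq]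
    have e : P₁⁻¹ * (P₂⁻¹ * Zᴴ) * (Z * P₂⁻¹ * P₁⁻¹) =
        P₁⁻¹ * (P₂⁻¹ * (Zᴴ * Z) * P₂⁻¹) * P₁⁻¹ := by simp only [mul_assoc]
    rw [e, ← hP₁R, mul_assoc, mul_assoc, Matrix.mul_nonsing_inv _ h1u, mul_one,
      Matrix.nonsing_inv_mul _ h1u]
  · refine posDef_sqrt_unique (posDef_conjMatrix hP₁) hP₁.inv ?_
    rw [← conjMatrix_mul, ← Matrix.mul_inv_rev, hP₁R, Matrix.mul_inv_rev, Matrix.mul_inv_rev,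
      Matrix.nonsing_inv_nonsing_inv _ h2u, conjMatrix_mul, conjMatrix_mul,
      conjMatrix_inv, hreal, ← hric]
    simp only [mul_assoc, Matrix.nonsing_inv_mul_cancel_left _ _ h2u,
      Matrix.mul_nonsing_inv _ h2u, mul_one]
  · rw [mul_assoc (Z * P₂⁻¹), Matrix.nonsing_inv_mul _ h1u, mul_one, mul_assoc,
      Matrix.nonsing_inv_mul _ h2u, mul_one]

namespace IsMostowFactorization

theorem gram (h : IsMostowFactorization Z W P₁ P₂) : Zᴴ * Z = P₂ * (P₁ * P₁) * P₂ := by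
  have hW : Wᴴ * W = 1 := Matrix.mem_unitaryGroup_iff'.1 h.unitary
  rw [h.product, Matrix.conjTranspose_mul, Matrix.conjTranspose_mul, h.posDef_one.isHermitian.eq,
    h.posDef_two.isHermitian.eq]
  have e : P₂ * (P₁ * Wᴴ) * (W * P₁ * P₂) = P₂ * (P₁ * (Wᴴ * W) * P₁) * P₂ := by
    simp only [mul_assoc]
  rw [e, hW, mul_one]

theorem isUnit (h : IsMostowFactorization Z W P₁ P₂) : IsUnit Z := by
  rw [h.product]
  refine (IsUnit.mul ?_ h.posDef_one.isUnit).mul h.posDef_two.isUnit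
  exact IsUnit.of_mul_eq_one _ (Matrix.mem_unitaryGroup_iff.1 h.unitary)

theorem riccati (h : IsMostowFactorization Z W P₁ P₂) :
    P₂ * P₂ * (Zᴴ * Z)⁻¹ * (P₂ * P₂) = conjMatrix (Zᴴ * Z) := by
  have h2u := isUnit_det_of_posDef h.posDef_two
  rw [h.gram, conjMatrix_mul, conjMatrix_mul, conjMatrix_mul, h.real, h.circular,
    Matrix.mul_inv_rev, Matrix.mul_inv_rev, Matrix.mul_inv_rev]
  simp only [mul_assoc, Matrix.mul_nonsing_inv_cancel_left _ _ h2u,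
    Matrix.nonsing_inv_mul_cancel_left _ _ h2u]

theorem posDef_sq (h : IsMostowFactorization Z W P₁ P₂) : (P₂ * P₂).PosDef :=
  posDef_mul_self_of_isHermitian h.posDef_two.isHermitian h.posDef_two.isUnit

theorem posDef_gram (h : IsMostowFactorization Z W P₁ P₂) : (Zᴴ * Z).PosDef :=
  posDef_conjTranspose_mul_self_of_isUnit h.isUnit

theorem unique {W' P₁' P₂' : Matrix (Fin n) (Fin n) ℂ} (h : IsMostowFactorization Z W P₁ P₂)
    (h' : IsMostowFactorization Z W' P₁' P₂') : W = W' ∧ P₁ = P₁' ∧ P₂ = P₂' := by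
  have e2 : P₂ = P₂' := posDef_sqrt_unique h.posDef_two h'.posDef_two
    (riccati_unique h.posDef_gram h.posDef_sq h'.posDef_sq (h.riccati.trans h'.riccati.symm))
  subst e2
  have e1 : P₁ = P₁' := by
    refine posDef_sqrt_unique h.posDef_one h'.posDef_one ?_
    exact h.posDef_two.isUnit.mul_left_cancel (h.posDef_two.isUnit.mul_right_cancel
      (h.gram.symm.trans h'.gram))
  subst e1
  exact ⟨h.posDef_one.isUnit.mul_right_cancel (h.posDef_two.isUnit.mul_right_cancel
      (h.product.symm.trans h'.product)), rfl, rfl⟩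

theorem isPosSqrt (h : IsMostowFactorization Z W P₁ P₂) :
    IsPosSqrt (twistedGram Z) ((Zᴴ * Z)⁻¹ * (P₂ * P₂)) := by
  refine ⟨?_, hasPosSpectrum_mul h.posDef_gram.inv h.posDef_sq⟩
  rw [twistedGram, ← h.riccati]
  simp only [mul_assoc]

end IsMostowFactorization

theorem isPosSqrt_unique {C C' : Matrix (Fin n) (Fin n) ℂ} {M : Matrix (Fin n) (Fin n) ℂ}
    (h : IsPosSqrt M C) (h' : IsPosSqrt M C') : C = C' :=
  rePosSpectrum_sqrt_unique (fun z hz => (h.2 z hz).1) (fun z hz => (h'.2 z hz).1)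
    (h.1.trans h'.1.symm)

theorem posSqrt_eq {C : Matrix (Fin n) (Fin n) ℂ} {M : Matrix (Fin n) (Fin n) ℂ}
    (h : IsPosSqrt M C) : posSqrt M = C := by
  have hex : ∃ C, IsPosSqrt M C := ⟨C, h⟩
  rw [posSqrt, dif_pos hex]
  exact isPosSqrt_unique hex.choose_spec h

theorem conjMatrix_ofRealMatrix (S : Matrix (Fin n) (Fin n) ℝ) :
    conjMatrix (ofRealMatrix S) = ofRealMatrix S := by
  ext i j; simp [conjMatrix, ofRealMatrix]

theorem conjMatrix_I_smul_ofRealMatrix (K : Matrix (Fin n) (Fin n) ℝ) :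
    conjMatrix (Complex.I • ofRealMatrix K) = -(Complex.I • ofRealMatrix K) := by
  ext i j; simp [conjMatrix, ofRealMatrix]

theorem isHermitian_ofRealMatrix {S : Matrix (Fin n) (Fin n) ℝ} (hS : Sᵀ = S) :
    (ofRealMatrix S).IsHermitian := by
  ext i j
  have := congrFun (congrFun hS i) j
  rw [Matrix.transpose_apply] at this
  simp [ofRealMatrix, this]

theorem isHermitian_I_smul_ofRealMatrix {K : Matrix (Fin n) (Fin n) ℝ} (hK : Kᵀ = -K) :
    (Complex.I • ofRealMatrix K).IsHermitian := by
  ext i j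
  have := congrFun (congrFun hK i) j
  rw [Matrix.transpose_apply, Matrix.neg_apply] at this
  simp [ofRealMatrix, this]

theorem ofRealMatrix_injective :
    Function.Injective (ofRealMatrix : Matrix (Fin n) (Fin n) ℝ → Matrix (Fin n) (Fin n) ℂ) :=
  Matrix.map_injective Complex.ofReal_injective

theorem IsMostow.factorization {K S : Matrix (Fin n) (Fin n) ℝ} (h : IsMostow Z W K S) :
    IsMostowFactorization Z W (NormedSpace.exp (Complex.I • ofRealMatrix K))
      (NormedSpace.exp (ofRealMatrix S)) where
  unitary := h.unitary
  posDef_one := posDef_exp (isHermitian_I_smul_ofRealMatrix h.skew)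
  posDef_two := posDef_exp (isHermitian_ofRealMatrix h.symmetric)
  circular := by rw [conjMatrix_exp, conjMatrix_I_smul_ofRealMatrix, Matrix.exp_neg]
  real := by rw [conjMatrix_exp, conjMatrix_ofRealMatrix]
  product := h.product

theorem IsMostowFactorization.exists_isMostow (h : IsMostowFactorization Z W P₁ P₂) :
    ∃ K S, IsMostow Z W K S := by
  obtain ⟨L, hL, rfl⟩ := exists_hermitian_log h.posDef_one
  obtain ⟨M, hM, rfl⟩ := exists_hermitian_log h.posDef_two
  have hMc : conjMatrix M = M := by
    refine exp_injective_of_isHermitian (isHermitian_conjMatrix hM) hM ?_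
    rw [← conjMatrix_exp, h.real]
  have hLc : conjMatrix L = -L := by
    refine exp_injective_of_isHermitian (isHermitian_conjMatrix hL) hL.neg ?_
    rw [← conjMatrix_exp, h.circular, Matrix.exp_neg]
  have eM : ofRealMatrix (M.map Complex.re) = M := by
    ext i j
    have := congrFun (congrFun hMc i) j
    simp only [conjMatrix, Matrix.map_apply] at this
    simpa [ofRealMatrix] using Complex.conj_eq_iff_re.1 this
  have eL : Complex.I • ofRealMatrix (L.map Complex.im) = L := by
    ext i j
    have := congrArg Complex.re (congrFun (congrFun hLc i) j)
    simp only [conjMatrix, Matrix.map_apply, Matrix.neg_apply, Complex.conj_re,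
      Complex.neg_re] at this
    apply Complex.ext
    · simp [ofRealMatrix]; linarith
    · simp [ofRealMatrix]
  refine ⟨L.map Complex.im, M.map Complex.re, h.unitary, ?_, ?_, ?_⟩
  · ext i j
    have := congrArg Complex.im (congrFun (congrFun hL.eq i) j)
    simp only [Matrix.conjTranspose_apply, Complex.star_def, Complex.conj_im] at this
    simp only [Matrix.transpose_apply, Matrix.map_apply, Matrix.neg_apply]
    linarith
  · ext i j
    have := congrArg Complex.re (congrFun (congrFun hM.eq i) j)
    simpa using this
  · rw [eM, eL]
    exact h.product

theorem existsUnique_isMostow (hZ : IsUnit Z) :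
    ∃! p : Matrix (Fin n) (Fin n) ℂ × Matrix (Fin n) (Fin n) ℝ × Matrix (Fin n) (Fin n) ℝ,
      IsMostow Z p.1 p.2.1 p.2.2 := by
  obtain ⟨W, P₁, P₂, h⟩ := exists_isMostowFactorization hZ
  obtain ⟨K, S, hKS⟩ := h.exists_isMostow
  refine ⟨(W, K, S), hKS, ?_⟩
  rintro ⟨W', K', S'⟩ h'
  simp only at h'
  obtain ⟨e0, e1, e2⟩ := h'.factorization.unique hKS.factorization
  have e1' := smul_right_injective _ Complex.I_ne_zero (exp_injective_of_isHermitian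
    (isHermitian_I_smul_ofRealMatrix h'.skew) (isHermitian_I_smul_ofRealMatrix hKS.skew) e1)
  have e2' := exp_injective_of_isHermitian
    (isHermitian_ofRealMatrix h'.symmetric) (isHermitian_ofRealMatrix hKS.symmetric) e2
  rw [e0, ofRealMatrix_injective e1', ofRealMatrix_injective e2']

theorem existsUnique_isPosSqrt (hZ : IsUnit Z) : ∃! C, IsPosSqrt (twistedGram Z) C := by
  obtain ⟨W, P₁, P₂, h⟩ := exists_isMostowFactorization hZ
  exact ⟨_, h.isPosSqrt, fun C hC => isPosSqrt_unique hC h.isPosSqrt⟩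

theorem isMostowFactorization_rho (hZ : IsUnit Z) :
    IsMostowFactorization Z (rho0 Z) (rho1 Z) (rho2 Z) := by
  have hex := (existsUnique_isMostow hZ).exists
  have h : IsMostow Z (mostowTriple Z).1 (mostowTriple Z).2.1 (mostowTriple Z).2.2 := by
    rw [mostowTriple, dif_pos hex]
    exact hex.choose_spec
  exact h.factorization

theorem posSqrt_twistedGram (hZ : IsUnit Z) :
    posSqrt (twistedGram Z) = (Zᴴ * Z)⁻¹ * (rho2 Z * rho2 Z) :=
  posSqrt_eq (isMostowFactorization_rho hZ).isPosSqrt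

end Factorization

/-! ### Differentiability of the three factor maps. -/

section Differentiability

open Filter Topology
open scoped MatrixOrder ComplexOrder

variable {n : ℕ} {Z X : Matrix (Fin n) (Fin n) ℂ}

/-- Entrywise conjugation as a continuous real-linear map. -/
noncomputable def conjCLM (n : ℕ) :
    Matrix (Fin n) (Fin n) ℂ →L[ℝ] Matrix (Fin n) (Fin n) ℂ :=
  LinearMap.toContinuousLinearMap
    { toFun := conjMatrix
      map_add' := fun A B => by ext i j; simp [conjMatrix]
      map_smul' := fun r A => by ext i j; simp [conjMatrix] }

theorem differentiableAt_inv {E : Type*} [NormedAddCommGroup E] [NormedSpace ℝ E]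
    {f : E → Matrix (Fin n) (Fin n) ℂ} {x : E} (hf : DifferentiableAt ℝ f x)
    (hu : IsUnit (f x)) : DifferentiableAt ℝ (fun y => (f y)⁻¹) x := by
  simp only [Matrix.nonsing_inv_eq_ringInverse]
  obtain ⟨u, hu⟩ := hu
  have h : DifferentiableAt ℝ Ring.inverse (f x) := by
    rw [← hu]; exact differentiableAt_inverse u.isUnit
  exact h.comp x hf

theorem eventually_isUnit (hZ : IsUnit Z) : ∀ᶠ Y in 𝓝 Z, IsUnit Y :=
  Units.isOpen.mem_nhds hZ

theorem differentiableAt_gram : DifferentiableAt ℝ (fun Y : Matrix (Fin n) (Fin n) ℂ => Yᴴ * Y) Z :=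
  (differentiableAt_id.star).mul differentiableAt_id

theorem differentiableAt_twistedGram (hZ : IsUnit Z) :
    DifferentiableAt ℝ (twistedGram : Matrix (Fin n) (Fin n) ℂ → _) Z := by
  have h1 := differentiableAt_inv (differentiableAt_gram (Z := Z))
    (isMostowFactorization_rho hZ).posDef_gram.isUnit
  exact h1.mul ((conjCLM n).differentiableAt.comp Z differentiableAt_gram)

theorem differentiableAt_posSqrt_twistedGram (hZ : IsUnit Z) :
    DifferentiableAt ℝ (fun Y : Matrix (Fin n) (Fin n) ℂ => posSqrt (twistedGram Y)) Z := by
  have h : ∀ᶠ Y in 𝓝 Z, IsPosSqrt (twistedGram Y) (posSqrt (twistedGram Y)) := by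
    filter_upwards [eventually_isUnit hZ] with Y hY
    rw [posSqrt_twistedGram hY]
    exact (isMostowFactorization_rho hY).isPosSqrt
  exact differentiableAt_of_mul_self (h.mono fun Y hY z hz => (hY.2 z hz).1)
    (h.mono fun Y hY => hY.1) (differentiableAt_twistedGram hZ)

theorem gram_mul_posSqrt (hZ : IsUnit Z) :
    Zᴴ * Z * posSqrt (twistedGram Z) = rho2 Z * rho2 Z := by
  rw [posSqrt_twistedGram hZ, Matrix.mul_nonsing_inv_cancel_left _ _
    (isUnit_det_of_posDef (isMostowFactorization_rho hZ).posDef_gram)]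

theorem conjTranspose_posSqrt_mul_gram (hZ : IsUnit Z) :
    (posSqrt (twistedGram Z))ᴴ * (Zᴴ * Z) = rho2 Z * rho2 Z := by
  have := congrArg Matrix.conjTranspose (gram_mul_posSqrt hZ)
  rw [Matrix.conjTranspose_mul, Matrix.conjTranspose_mul, Matrix.conjTranspose_mul,
    Matrix.conjTranspose_conjTranspose,
    (isMostowFactorization_rho hZ).posDef_two.isHermitian.eq] at this
  exact this

theorem sq_mul_posSqrt (hZ : IsUnit Z) :
    rho2 Z * rho2 Z * posSqrt (twistedGram Z) = conjMatrix (Zᴴ * Z) := by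
  rw [posSqrt_twistedGram hZ, ← (isMostowFactorization_rho hZ).riccati]
  simp only [mul_assoc]

theorem differentiableAt_rho2 (hZ : IsUnit Z) :
    DifferentiableAt ℝ (rho2 : Matrix (Fin n) (Fin n) ℂ → _) Z := by
  refine differentiableAt_of_mul_self (h := fun Y => Yᴴ * Y * posSqrt (twistedGram Y)) ?_ ?_
    (differentiableAt_gram.mul (differentiableAt_posSqrt_twistedGram hZ))
  · filter_upwards [eventually_isUnit hZ] with Y hY
    exact (hasPosSpectrum_of_posDef (isMostowFactorization_rho hY).posDef_two).rePos
  · filter_upwards [eventually_isUnit hZ] with Y hY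
    exact (gram_mul_posSqrt hY).symm

theorem differentiableAt_rho1 (hZ : IsUnit Z) :
    DifferentiableAt ℝ (rho1 : Matrix (Fin n) (Fin n) ℂ → _) Z := by
  have hi := differentiableAt_inv (differentiableAt_rho2 hZ)
    (isMostowFactorization_rho hZ).posDef_two.isUnit
  refine differentiableAt_of_mul_self (h := fun Y => (rho2 Y)⁻¹ * (Yᴴ * Y) * (rho2 Y)⁻¹) ?_ ?_
    ((hi.mul differentiableAt_gram).mul hi)
  · filter_upwards [eventually_isUnit hZ] with Y hY
    exact (hasPosSpectrum_of_posDef (isMostowFactorization_rho hY).posDef_one).rePos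
  · filter_upwards [eventually_isUnit hZ] with Y hY
    have h := isMostowFactorization_rho hY
    have hu := isUnit_det_of_posDef h.posDef_two
    rw [h.gram]
    simp only [mul_assoc, Matrix.nonsing_inv_mul_cancel_left _ _ hu, Matrix.mul_nonsing_inv _ hu,
      mul_one]

theorem IsMostowFactorization.unitary_eq {W P₁ P₂ : Matrix (Fin n) (Fin n) ℂ}
    (h : IsMostowFactorization Z W P₁ P₂) : W = Z * P₂⁻¹ * P₁⁻¹ := by
  rw [h.product, Matrix.mul_nonsing_inv_cancel_right _ _ (isUnit_det_of_posDef h.posDef_two),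
    Matrix.mul_nonsing_inv_cancel_right _ _ (isUnit_det_of_posDef h.posDef_one)]

theorem differentiableAt_rho0 (hZ : IsUnit Z) :
    DifferentiableAt ℝ (rho0 : Matrix (Fin n) (Fin n) ℂ → _) Z := by
  have h := isMostowFactorization_rho hZ
  have hd := (differentiableAt_id.mul (differentiableAt_inv (differentiableAt_rho2 hZ)
    h.posDef_two.isUnit)).mul (differentiableAt_inv (differentiableAt_rho1 hZ) h.posDef_one.isUnit)
  refine hd.congr_of_eventuallyEq ?_
  filter_upwards [eventually_isUnit hZ] with Y hY
  exact (isMostowFactorization_rho hY).unitary_eq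

end Differentiability

/-! ### Relations obtained by differentiating the defining identities. -/

section DerivativeIdentities

open Filter Topology
open scoped MatrixOrder ComplexOrder

variable {n : ℕ} {Z : Matrix (Fin n) (Fin n) ℂ}

theorem hasDerivAt_line {f : Matrix (Fin n) (Fin n) ℂ → Matrix (Fin n) (Fin n) ℂ}
    (hf : DifferentiableAt ℝ f Z) (X : Matrix (Fin n) (Fin n) ℂ) :
    HasDerivAt (fun t : ℝ => f (Z + t • X)) (fderiv ℝ f Z X) 0 :=
  hf.hasFDerivAt.hasLineDerivAt X

theorem eventually_line (X : Matrix (Fin n) (Fin n) ℂ) {p : Matrix (Fin n) (Fin n) ℂ → Prop}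
    (h : ∀ᶠ Y in 𝓝 Z, p Y) : ∀ᶠ t : ℝ in 𝓝 0, p (Z + t • X) := by
  have hc : Tendsto (fun t : ℝ => Z + t • X) (𝓝 0) (𝓝 (Z + (0 : ℝ) • X)) :=
    Continuous.tendsto (by fun_prop) 0
  rw [zero_smul, add_zero] at hc
  exact hc.eventually h

theorem deriv_line_unique {F G : Matrix (Fin n) (Fin n) ℂ → Matrix (Fin n) (Fin n) ℂ}
    {X a b : Matrix (Fin n) (Fin n) ℂ} (hF : HasDerivAt (fun t : ℝ => F (Z + t • X)) a 0)
    (hG : HasDerivAt (fun t : ℝ => G (Z + t • X)) b 0) (h : ∀ᶠ Y in 𝓝 Z, F Y = G Y) : a = b := by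
  refine hF.unique (hG.congr_of_eventuallyEq ?_)
  exact eventually_line X h

theorem hasDerivAt_line_id (X : Matrix (Fin n) (Fin n) ℂ) :
    HasDerivAt (fun t : ℝ => Z + t • X) X 0 := by
  simpa using hasDerivAt_line (f := id) (Z := Z) differentiableAt_id X

theorem hasDerivAt_line_gram (X : Matrix (Fin n) (Fin n) ℂ) :
    HasDerivAt (fun t : ℝ => (Z + t • X)ᴴ * (Z + t • X)) (Xᴴ * Z + Zᴴ * X) 0 := by
  have h := (hasDerivAt_line_id (Z := Z) X).star.mul (hasDerivAt_line_id (Z := Z) X)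
  refine HasDerivAt.congr_deriv
    (f := fun t : ℝ => (Z + t • X)ᴴ * (Z + t • X)) h ?_
  simp [Matrix.star_eq_conjTranspose]

variable (hZ : IsUnit Z) (X : Matrix (Fin n) (Fin n) ℂ)

include hZ

theorem fderiv_rho0_skew :
    (fderiv ℝ rho0 Z X)ᴴ * rho0 Z + (rho0 Z)ᴴ * fderiv ℝ rho0 Z X = 0 := by
  have h0 := hasDerivAt_line (differentiableAt_rho0 hZ) X
  have h := h0.star.mul h0
  have e := deriv_line_unique (F := fun Y => star (rho0 Y) * rho0 Y) (G := fun _ => 1) h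
    (hasDerivAt_const _ _) (by
      filter_upwards [eventually_isUnit hZ] with Y hY
      exact Matrix.mem_unitaryGroup_iff'.1 (isMostowFactorization_rho hY).unitary)
  simpa [Matrix.star_eq_conjTranspose] using e

theorem fderiv_product :
    X = fderiv ℝ rho0 Z X * rho1 Z * rho2 Z + rho0 Z * fderiv ℝ rho1 Z X * rho2 Z +
      rho0 Z * rho1 Z * fderiv ℝ rho2 Z X := by
  have h0 := hasDerivAt_line (differentiableAt_rho0 hZ) X
  have h1 := hasDerivAt_line (differentiableAt_rho1 hZ) X
  have h2 := hasDerivAt_line (differentiableAt_rho2 hZ) X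
  have e := deriv_line_unique (F := fun Y => Y) (G := fun Y => rho0 Y * rho1 Y * rho2 Y)
    (hasDerivAt_line_id X) ((h0.mul h1).mul h2) (by
      filter_upwards [eventually_isUnit hZ] with Y hY
      exact (isMostowFactorization_rho hY).product)
  simpa [add_mul] using e

theorem fderiv_rho1_circular :
    conjMatrix (fderiv ℝ rho1 Z X) * rho1 Z + (rho1 Z)⁻¹ * fderiv ℝ rho1 Z X = 0 := by
  have h1 := hasDerivAt_line (differentiableAt_rho1 hZ) X
  have h1c : HasDerivAt (fun t : ℝ => conjMatrix (rho1 (Z + t • X)))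
      (conjMatrix (fderiv ℝ rho1 Z X)) 0 := (conjCLM n).hasFDerivAt.comp_hasDerivAt _ h1
  have e := deriv_line_unique (F := fun Y => conjMatrix (rho1 Y) * rho1 Y) (G := fun _ => 1)
    (h1c.mul h1) (hasDerivAt_const _ _) (by
      filter_upwards [eventually_isUnit hZ] with Y hY
      have h := isMostowFactorization_rho hY
      rw [h.circular, Matrix.nonsing_inv_mul _ (isUnit_det_of_posDef h.posDef_one)])
  simpa [(isMostowFactorization_rho hZ).circular] using e

theorem fderiv_rho1_isHermitian : (fderiv ℝ rho1 Z X).IsHermitian := by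
  have h1 := hasDerivAt_line (differentiableAt_rho1 hZ) X
  exact deriv_line_unique (F := fun Y => star (rho1 Y)) (G := rho1) h1.star h1 (by
    filter_upwards [eventually_isUnit hZ] with Y hY
    exact (isMostowFactorization_rho hY).posDef_one.isHermitian.eq)

theorem fderiv_rho2_isHermitian : (fderiv ℝ rho2 Z X).IsHermitian := by
  have h1 := hasDerivAt_line (differentiableAt_rho2 hZ) X
  exact deriv_line_unique (F := fun Y => star (rho2 Y)) (G := rho2) h1.star h1 (by
    filter_upwards [eventually_isUnit hZ] with Y hY
    exact (isMostowFactorization_rho hY).posDef_two.isHermitian.eq)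

theorem fderiv_rho2_real : conjMatrix (fderiv ℝ rho2 Z X) = fderiv ℝ rho2 Z X := by
  have h1 := hasDerivAt_line (differentiableAt_rho2 hZ) X
  have h1c : HasDerivAt (fun t : ℝ => conjMatrix (rho2 (Z + t • X)))
      (conjMatrix (fderiv ℝ rho2 Z X)) 0 := (conjCLM n).hasFDerivAt.comp_hasDerivAt _ h1
  exact deriv_line_unique (F := fun Y => conjMatrix (rho2 Y)) (G := rho2) h1c h1 (by
    filter_upwards [eventually_isUnit hZ] with Y hY
    exact (isMostowFactorization_rho hY).real)

/-- The Sylvester equation for the derivative of `B = P₂²`. -/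
theorem fderiv_rho2_sylvester :
    (posSqrt (twistedGram Z))ᴴ * (fderiv ℝ rho2 Z X * rho2 Z + rho2 Z * fderiv ℝ rho2 Z X) +
      (fderiv ℝ rho2 Z X * rho2 Z + rho2 Z * fderiv ℝ rho2 Z X) * posSqrt (twistedGram Z) =
    conjMatrix (Xᴴ * Z + Zᴴ * X) +
      (posSqrt (twistedGram Z))ᴴ * (Xᴴ * Z + Zᴴ * X) * posSqrt (twistedGram Z) := by
  have h2 := hasDerivAt_line (differentiableAt_rho2 hZ) X
  have hC := hasDerivAt_line (differentiableAt_posSqrt_twistedGram hZ) X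
  have hA := hasDerivAt_line_gram (Z := Z) X
  have hAc : HasDerivAt (fun t : ℝ => conjMatrix ((Z + t • X)ᴴ * (Z + t • X)))
      (conjMatrix (Xᴴ * Z + Zᴴ * X)) 0 := (conjCLM n).hasFDerivAt.comp_hasDerivAt _ hA
  set c := fderiv ℝ (fun Y => posSqrt (twistedGram Y)) Z X
  set D := fderiv ℝ rho2 Z X
  have e1 := deriv_line_unique (F := fun Y => Yᴴ * Y * posSqrt (twistedGram Y))
    (G := fun Y => rho2 Y * rho2 Y) (hA.mul hC) (h2.mul h2) (by
      filter_upwards [eventually_isUnit hZ] with Y hY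
      exact gram_mul_posSqrt hY)
  have e2 := deriv_line_unique (F := fun Y => rho2 Y * rho2 Y * posSqrt (twistedGram Y))
    (G := fun Y => conjMatrix (Yᴴ * Y)) ((h2.mul h2).mul hC) hAc (by
      filter_upwards [eventually_isUnit hZ] with Y hY
      exact sq_mul_posSqrt hY)
  simp only [zero_smul, add_zero, Pi.mul_apply] at e1 e2
  -- Since `B = C*A`, the term `Bc` in the second relation is `C*(Ac)`; the first relation,
  -- multiplied by `C*`, eliminates `c`.
  have hB := (conjTranspose_posSqrt_mul_gram hZ).symm
  set C := posSqrt (twistedGram Z)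
  rw [← e2, hB, ← e1]
  noncomm_ring

end DerivativeIdentities

/-! ### Exponential decay, convergence of `β`, and the two Sylvester bounds. -/

section SylvesterBounds

open Filter Topology MeasureTheory
open scoped MatrixOrder ComplexOrder

variable {n : ℕ} {N : Seminorm ℂ (Matrix (Fin n) (Fin n) ℂ)} {Z A B P X Y : Matrix (Fin n) (Fin n) ℂ}

theorem norm_exp_neg_smul_conjTranspose (C : Matrix (Fin n) (Fin n) ℂ) (t : ℝ) :
    ‖NormedSpace.exp ((-t) • Cᴴ)‖ = ‖NormedSpace.exp ((-t) • C)‖ := by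
  have e : (-t) • Cᴴ = ((-t) • C)ᴴ := by simp
  rw [e, Matrix.exp_conjTranspose, Matrix.l2_opNorm_conjTranspose]

theorem norm_inv_pos [Nonempty (Fin n)] (hP : P.PosDef) : 0 < ‖P⁻¹‖ :=
  norm_pos_iff.2 hP.inv.isUnit.ne_zero

theorem IsUnitarilyInvariantNorm.le_of_sylvester_posDef [Nonempty (Fin n)]
    (hN : IsUnitarilyInvariantNorm N) (hP : P.PosDef) (h : P * X + X * P = Y) :
    N X ≤ ‖P⁻¹‖ / 2 * N Y := by
  have hpos := norm_inv_pos hP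
  -- Each exponential decays at rate `‖P⁻¹‖⁻¹`, the least eigenvalue; the integral of `e^{at}` is
  -- then `‖P⁻¹‖ / 2`.
  set a : ℝ := -(2 * ‖P⁻¹‖⁻¹) with ha_def
  have ha : a < 0 := by
    have := inv_pos.2 hpos
    linarith
  have hb : ∀ t : ℝ, 0 < t →
      ‖NormedSpace.exp ((-t) • P)‖ * ‖NormedSpace.exp ((-t) • P)‖ ≤ Real.exp (a * t) := by
    intro t ht
    have := norm_exp_neg_smul_le hP ht.le
    calc _ ≤ Real.exp (-(‖P⁻¹‖⁻¹ * t)) * Real.exp (-(‖P⁻¹‖⁻¹ * t)) := by gcongr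
      _ = Real.exp (a * t) := by rw [← Real.exp_add]; congr 1; rw [ha_def]; ring
  have hlim : Tendsto (fun t => Real.exp (a * t)) atTop (𝓝 0) :=
    Real.tendsto_exp_atBot.comp (tendsto_id.const_mul_atTop_of_neg ha)
  have := hN.le_of_sylvester h (integrableOn_exp_mul_Ioi ha 0) hb
    (squeeze_zero' (Eventually.of_forall fun t => by positivity)
      ((eventually_gt_atTop 0).mono hb) hlim)
  rw [integral_exp_mul_Ioi ha] at this
  refine this.trans_eq ?_
  rw [ha_def, mul_zero, Real.exp_zero]
  field_simp

/-- The product is similar to a positive definite matrix, whose exponential decays; the similarity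
costs only the constant `‖G‖‖G⁻¹‖`. -/
theorem exists_exp_decay [Nonempty (Fin n)] (hA : A.PosDef) (hB : B.PosDef) :
    ∃ K c : ℝ, 0 < c ∧ ∀ t : ℝ, 0 ≤ t →
      ‖NormedSpace.exp ((-t) • (A * B))‖ ≤ K * Real.exp (-(c * t)) := by
  obtain ⟨G, hG, rfl⟩ := exists_posDef_sqrt hA
  have hS := posDef_conjugate hB hG.isHermitian hG.isUnit
  have hu := isUnit_det_of_posDef hG
  refine ⟨‖G‖ * ‖G⁻¹‖, ‖(G * B * G)⁻¹‖⁻¹, inv_pos.2 (norm_inv_pos hS), fun t ht => ?_⟩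
  have e : (-t) • (G * G * B) = G * ((-t) • (G * B * G)) * G⁻¹ := by
    rw [mul_smul_comm, smul_mul_assoc]
    simp only [mul_assoc, Matrix.mul_nonsing_inv _ hu, mul_one]
  rw [e, Matrix.exp_conj _ _ hG.isUnit]
  calc _ ≤ ‖G‖ * ‖NormedSpace.exp ((-t) • (G * B * G))‖ * ‖G⁻¹‖ := norm_mul₃_le
    _ ≤ ‖G‖ * Real.exp (-(‖(G * B * G)⁻¹‖⁻¹ * t)) * ‖G⁻¹‖ := by
      have := norm_exp_neg_smul_le hS ht
      gcongr
    _ = _ := by ring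

theorem exists_betaIntegrand_le (hZ : IsUnit Z) :
    ∃ K a : ℝ, a < 0 ∧ ∀ t : ℝ, 0 ≤ t → betaIntegrand Z t ≤ K * Real.exp (a * t) := by
  rcases isEmpty_or_nonempty (Fin n) with hn | hn
  · refine ⟨0, -1, by norm_num, fun t _ => ?_⟩
    have : NormedSpace.exp ((-t) • posSqrt (twistedGram Z)) = 0 := Subsingleton.elim _ _
    rw [betaIntegrand, this]
    simp
  have h := isMostowFactorization_rho hZ
  obtain ⟨K, c, hc, hK⟩ := exists_exp_decay h.posDef_gram.inv h.posDef_sq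
  refine ⟨K ^ 2, -(2 * c), by linarith, fun t ht => ?_⟩
  rw [betaIntegrand, posSqrt_twistedGram hZ]
  calc _ ≤ (K * Real.exp (-(c * t))) ^ 2 := by
        have := hK t ht
        gcongr
    _ = K ^ 2 * Real.exp (-(2 * c) * t) := by
        rw [mul_pow, ← Real.exp_nat_mul]; congr 2; push_cast; ring

theorem integrableOn_betaIntegrand (hZ : IsUnit Z) :
    IntegrableOn (betaIntegrand Z) (Set.Ioi 0) := by
  obtain ⟨K, a, ha, hK⟩ := exists_betaIntegrand_le hZ
  have hcont : Continuous (betaIntegrand Z) :=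
    (continuous_iff_continuousAt.2 fun t =>
      (hasDerivAt_exp_neg_smul (posSqrt (twistedGram Z)) t).continuousAt).norm.pow 2
  refine ((integrableOn_exp_mul_Ioi ha 0).const_mul K).mono' hcont.aestronglyMeasurable ?_
  filter_upwards [ae_restrict_mem measurableSet_Ioi] with t ht
  rw [Real.norm_of_nonneg (by rw [betaIntegrand]; positivity)]
  exact hK t (le_of_lt ht)

theorem IsUnitarilyInvariantNorm.le_beta_mul (hN : IsUnitarilyInvariantNorm N) (hZ : IsUnit Z)
    (h : (posSqrt (twistedGram Z))ᴴ * X + X * posSqrt (twistedGram Z) = Y) :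
    N X ≤ beta Z * N Y := by
  have e : ∀ t : ℝ, ‖NormedSpace.exp ((-t) • (posSqrt (twistedGram Z))ᴴ)‖ *
      ‖NormedSpace.exp ((-t) • posSqrt (twistedGram Z))‖ = betaIntegrand Z t := by
    intro t
    rw [norm_exp_neg_smul_conjTranspose, betaIntegrand, sq]
  obtain ⟨K, a, ha, hK⟩ := exists_betaIntegrand_le hZ
  have hlim : Tendsto (fun t => K * Real.exp (a * t)) atTop (𝓝 0) := by
    have := (Real.tendsto_exp_atBot.comp (tendsto_id.const_mul_atTop_of_neg ha)).const_mul K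
    rwa [mul_zero] at this
  refine hN.le_of_sylvester h (integrableOn_betaIntegrand hZ) (fun t _ => (e t).le) ?_
  simp only [e]
  exact squeeze_zero' (Eventually.of_forall fun t => by rw [betaIntegrand]; positivity)
    ((eventually_ge_atTop 0).mono hK) hlim

theorem beta_nonneg (Z : Matrix (Fin n) (Fin n) ℂ) : 0 ≤ beta Z :=
  integral_nonneg fun t => by rw [betaIntegrand]; positivity

theorem isUnitarilyInvariantNorm_norm :
    IsUnitarilyInvariantNorm (normSeminorm ℂ (Matrix (Fin n) (Fin n) ℂ)) where
  definite := fun A h => norm_eq_zero.1 h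
  unitary_invariant := fun U hU V hV A => by
    rw [coe_normSeminorm, CStarRing.norm_mul_mem_unitary _ hV, CStarRing.norm_mem_unitary_mul _ hU]

theorem norm_conjMatrix (A : Matrix (Fin n) (Fin n) ℂ) : ‖conjMatrix A‖ = ‖A‖ := by
  refine le_antisymm (isUnitarilyInvariantNorm_norm.conjMatrix_le A) ?_
  conv_lhs => rw [← conjMatrix_conjMatrix A]
  exact isUnitarilyInvariantNorm_norm.conjMatrix_le _

/-- `C*A + AC = 2B` and `C*B + BC = 2 conj A` give `‖A‖ ≤ 2β‖B‖` and `‖B‖ ≤ 2β‖A‖`, so `2β < 1` is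
impossible. -/
theorem half_le_beta [Nonempty (Fin n)] (hZ : IsUnit Z) : 1 / 2 ≤ beta Z := by
  have h := isMostowFactorization_rho hZ
  have hN := isUnitarilyInvariantNorm_norm (n := n)
  have h1 := hN.le_beta_mul (X := Zᴴ * Z) hZ rfl
  have hB : (posSqrt (twistedGram Z))ᴴ * (rho2 Z * rho2 Z) = conjMatrix (Zᴴ * Z) := by
    have := congrArg Matrix.conjTranspose (sq_mul_posSqrt hZ)
    rwa [Matrix.conjTranspose_mul, h.posDef_sq.isHermitian.eq,
      (posDef_conjMatrix h.posDef_gram).isHermitian.eq] at this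
  have h2 := hN.le_beta_mul (X := rho2 Z * rho2 Z) hZ rfl
  rw [conjTranspose_posSqrt_mul_gram hZ, gram_mul_posSqrt hZ] at h1
  rw [hB, sq_mul_posSqrt hZ] at h2
  simp only [coe_normSeminorm] at h1 h2
  have h3 := h1.trans (mul_le_mul_of_nonneg_left (norm_add_le _ _) (beta_nonneg Z))
  have h4 := h2.trans (mul_le_mul_of_nonneg_left (norm_add_le _ _) (beta_nonneg Z))
  rw [norm_conjMatrix] at h4
  have hpos : 0 < ‖Zᴴ * Z‖ := norm_pos_iff.2 h.posDef_gram.isUnit.ne_zero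
  have hb := beta_nonneg Z
  by_contra hlt
  rw [not_le] at hlt
  have hB0 := norm_nonneg (rho2 Z * rho2 Z)
  nlinarith

end SylvesterBounds

/-! ### Norms of the factors in terms of `Z`. -/

section FactorNorms

open scoped MatrixOrder ComplexOrder

variable {n : ℕ} {Z W P₁ P₂ : Matrix (Fin n) (Fin n) ℂ}

namespace IsMostowFactorization

/-- `(BZ⁻¹)(BZ⁻¹)* = BA⁻¹B = conj A`, whose norm is `‖Z‖²`. This bounds both `P₂` and `C =
Z⁻¹(BZ⁻¹)*`. -/
theorem norm_sq_mul_inv (h : IsMostowFactorization Z W P₁ P₂) : ‖P₂ * P₂ * Z⁻¹‖ = ‖Z‖ := by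
  have e : P₂ * P₂ * Z⁻¹ * (P₂ * P₂ * Z⁻¹)ᴴ = conjMatrix (Zᴴ * Z) := by
    rw [← h.riccati, Matrix.conjTranspose_mul, h.posDef_sq.isHermitian.eq,
      Matrix.conjTranspose_nonsing_inv, Matrix.mul_inv_rev]
    simp only [mul_assoc]
  have h1 := CStarRing.norm_self_mul_star (x := P₂ * P₂ * Z⁻¹)
  rw [Matrix.star_eq_conjTranspose, e, norm_conjMatrix,
    Matrix.l2_opNorm_conjTranspose_mul_self] at h1
  exact (mul_self_inj (norm_nonneg _) (norm_nonneg _)).1 h1.symm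

theorem isUnit_det (h : IsMostowFactorization Z W P₁ P₂) : IsUnit Z.det :=
  (Matrix.isUnit_iff_isUnit_det _).1 h.isUnit

theorem norm_two_le (h : IsMostowFactorization Z W P₁ P₂) : ‖P₂‖ ≤ ‖Z‖ := by
  have e : P₂ * P₂ = P₂ * P₂ * Z⁻¹ * Z := by
    rw [Matrix.nonsing_inv_mul_cancel_right _ _ h.isUnit_det]
  have h1 : ‖P₂ * P₂‖ ≤ ‖Z‖ * ‖Z‖ := by
    rw [e]
    exact (norm_mul_le _ _).trans (by rw [h.norm_sq_mul_inv])
  have h2 := Matrix.l2_opNorm_conjTranspose_mul_self P₂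
  rw [h.posDef_two.isHermitian.eq] at h2
  rw [h2] at h1
  exact abs_le_of_sq_le_sq' (by nlinarith) (norm_nonneg _) |>.2

theorem norm_sqrt_le (h : IsMostowFactorization Z W P₁ P₂) :
    ‖(Zᴴ * Z)⁻¹ * (P₂ * P₂)‖ ≤ cond Z := by
  have e : (Zᴴ * Z)⁻¹ * (P₂ * P₂) = Z⁻¹ * (P₂ * P₂ * Z⁻¹)ᴴ := by
    rw [Matrix.conjTranspose_mul, h.posDef_sq.isHermitian.eq,
      Matrix.conjTranspose_nonsing_inv, Matrix.mul_inv_rev, mul_assoc]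
  rw [e, cond, mul_comm]
  refine (norm_mul_le _ _).trans ?_
  rw [Matrix.l2_opNorm_conjTranspose, h.norm_sq_mul_inv]

/-- The inverse Riccati equation `B⁻¹AB⁻¹ = (conj A)⁻¹` gives `‖ZB⁻¹‖ = ‖Z⁻¹‖`, hence `‖B⁻¹‖ ≤
‖Z⁻¹‖²`. -/
theorem norm_two_inv_le (h : IsMostowFactorization Z W P₁ P₂) : ‖P₂⁻¹‖ ≤ ‖Z⁻¹‖ := by
  have hu2 := isUnit_det_of_posDef h.posDef_sq
  have huA := isUnit_det_of_posDef h.posDef_gram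
  have e : (Z * (P₂ * P₂)⁻¹)ᴴ * (Z * (P₂ * P₂)⁻¹) = conjMatrix (Zᴴ * Z)⁻¹ := by
    rw [conjMatrix_inv, ← h.riccati, Matrix.mul_inv_rev (_ * _) (P₂ * P₂),
      Matrix.mul_inv_rev (P₂ * P₂), Matrix.nonsing_inv_nonsing_inv _ huA,
      Matrix.conjTranspose_mul, h.posDef_sq.inv.isHermitian.eq]
    simp only [mul_assoc]
  have h1 := Matrix.l2_opNorm_conjTranspose_mul_self (Z * (P₂ * P₂)⁻¹)
  rw [e, norm_conjMatrix, Matrix.mul_inv_rev, ← Matrix.conjTranspose_nonsing_inv] at h1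
  have h2 := CStarRing.norm_self_mul_star (x := Z⁻¹)
  rw [Matrix.star_eq_conjTranspose] at h2
  rw [h2] at h1
  have h3 := (mul_self_inj (norm_nonneg _) (norm_nonneg _)).1 h1
  have h4 : (P₂ * P₂)⁻¹ = Z⁻¹ * (Z * (P₂ * P₂)⁻¹) := by
    rw [Matrix.nonsing_inv_mul_cancel_left _ _ h.isUnit_det]
  have h5 : ‖(P₂ * P₂)⁻¹‖ ≤ ‖Z⁻¹‖ * ‖Z⁻¹‖ := by
    rw [h4]
    exact (norm_mul_le _ _).trans (by rw [← h3])
  have h6 := Matrix.l2_opNorm_conjTranspose_mul_self P₂⁻¹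
  rw [h.posDef_two.inv.isHermitian.eq] at h6
  rw [Matrix.mul_inv_rev, h6] at h5
  exact abs_le_of_sq_le_sq' (by nlinarith) (norm_nonneg _) |>.2

theorem norm_one_inv (h : IsMostowFactorization Z W P₁ P₂) : ‖P₁⁻¹‖ = ‖P₁‖ := by
  rw [← h.circular, norm_conjMatrix]

theorem norm_one_le (h : IsMostowFactorization Z W P₁ P₂) : ‖P₁‖ ≤ cond Z := by
  have hW : Wᴴ * W = 1 := Matrix.mem_unitaryGroup_iff'.1 h.unitary
  have hW' : Wᴴ ∈ Matrix.unitaryGroup (Fin n) ℂ := Unitary.star_mem h.unitary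
  have e : P₁ = Wᴴ * (Z * P₂⁻¹) := by
    conv_rhs => rw [h.product]
    rw [Matrix.mul_nonsing_inv_cancel_right _ _ (isUnit_det_of_posDef h.posDef_two), ← mul_assoc,
      hW, one_mul]
  rw [e, norm_unitary_mul hW', cond]
  refine (norm_mul_le _ _).trans ?_
  have := h.norm_two_inv_le
  gcongr

theorem one_le_norm_one [Nonempty (Fin n)] (h : IsMostowFactorization Z W P₁ P₂) : 1 ≤ ‖P₁‖ := by
  have h1 : ‖P₁ * P₁⁻¹‖ ≤ ‖P₁‖ * ‖P₁⁻¹‖ := norm_mul_le _ _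
  rw [Matrix.mul_nonsing_inv _ (isUnit_det_of_posDef h.posDef_one), h.norm_one_inv,
    CStarRing.norm_one] at h1
  nlinarith [norm_nonneg P₁]

theorem norm_one_sub_one_le [Nonempty (Fin n)] (h : IsMostowFactorization Z W P₁ P₂) :
    ‖P₁ - 1‖ ≤ ‖P₁‖ - 1 := by
  have h1 := h.one_le_norm_one
  have := norm_sub_algebraMap_le h.posDef_one (c := 1) (r := ‖P₁‖ - 1) (by linarith)
    (fun x hx0 hx hx' => by
      rw [h.norm_one_inv] at hx'
      rw [abs_le]
      constructor
      · nlinarith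
      · linarith)
  rwa [map_one] at this

theorem exists_norm_two_inv_sub_le [Nonempty (Fin n)] (h : IsMostowFactorization Z W P₁ P₂) :
    ∃ c : ℝ, ‖P₂⁻¹ - algebraMap ℝ (Matrix (Fin n) (Fin n) ℂ) c‖ ≤
      ‖P₂⁻¹‖ * (1 - (cond Z)⁻¹) / 2 := by
  have hk : 1 ≤ cond Z := h.one_le_norm_one.trans h.norm_one_le
  have hki : (cond Z)⁻¹ ≤ 1 := inv_le_one_of_one_le₀ hk
  -- The spectrum of `P₂⁻¹` lies in `[q/k, q]` with `q = ‖P₂⁻¹‖`; this is the midpoint, and the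
  -- radius is half the length.
  refine ⟨‖P₂⁻¹‖ * (1 + (cond Z)⁻¹) / 2, norm_sub_algebraMap_le h.posDef_two.inv ?_ ?_⟩
  · have := norm_nonneg P₂⁻¹
    have : 0 ≤ 1 - (cond Z)⁻¹ := by linarith
    positivity
  · intro x hx0 hx hx'
    rw [Matrix.nonsing_inv_nonsing_inv _ (isUnit_det_of_posDef h.posDef_two)] at hx'
    have h1 : ‖P₂⁻¹‖ * (cond Z)⁻¹ ≤ x := by
      rw [← div_eq_mul_inv, div_le_iff₀ (by linarith)]
      have h2 : 1 ≤ x * ‖Z‖ := hx'.trans (by have := h.norm_two_le; gcongr)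
      calc ‖P₂⁻¹‖ ≤ 1 * ‖Z⁻¹‖ := by rw [one_mul]; exact h.norm_two_inv_le
        _ ≤ x * ‖Z‖ * ‖Z⁻¹‖ := by gcongr
        _ = x * cond Z := by rw [cond, mul_assoc]
    rw [abs_le]
    constructor <;> linarith

end IsMostowFactorization

end FactorNorms

/-! ### Real inequalities, with `p = ‖P₁‖`, `k = cond Z`, `b = β`, `d` the bound for `P₂'`. -/

section ScalarEstimates

variable {p k b d : ℝ}

theorem scalar_bound_unitary (hp : 1 ≤ p) (hpk : p ≤ k) (hb : 1 / 2 ≤ b)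
    (hd : d = b * k * (1 + k ^ 2)) :
    2 + d * (1 - k⁻¹ + 2 * (p - 1)) ≤ 1 + p * b * k * (1 + k ^ 4) := by
  have hk : 1 ≤ k := hp.trans hpk
  have e : d * (1 - k⁻¹ + 2 * (p - 1)) = b * (1 + k ^ 2) * (2 * p * k - k - 1) := by
    have : k ≠ 0 := by positivity
    rw [hd]; field_simp; ring
  rw [e]
  suffices h : 2 ≤ p * k * (1 + k ^ 4) - (1 + k ^ 2) * (2 * p * k - k - 1) by nlinarith
  -- The expression is affine in `p` with slope `k(k⁴ - 2k² - 1)`, so its minimum over `1 ≤ p ≤ k`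
  -- is at `p = 1` or `p = k` according to this sign.
  rcases le_total 0 (k ^ 4 - 2 * k ^ 2 - 1) with hs | hs
  · have h1 : 0 ≤ (p - 1) * k * (k ^ 4 - 2 * k ^ 2 - 1) := by
      have : 0 ≤ p - 1 := by linarith
      positivity
    have h2 : 0 ≤ k ^ 3 * (k ^ 2 - 1) := mul_nonneg (by positivity) (by nlinarith)
    nlinarith
  · have h1 : 0 ≤ (k - p) * k * -(k ^ 4 - 2 * k ^ 2 - 1) :=
      mul_nonneg (mul_nonneg (by linarith) (by linarith)) (by linarith)
    have h2 : 0 ≤ k ^ 2 * (k - 1) := mul_nonneg (by positivity) (by linarith)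
    nlinarith [sq_nonneg (k * (k ^ 2 - 1))]

theorem scalar_bound_circular (hp : 1 ≤ p) (hpk : p ≤ k) (hb : 1 / 2 ≤ b)
    (hd : d = b * k * (1 + k ^ 2)) :
    p + (1 - k⁻¹) * d ≤ b * k * (1 + k ^ 4) := by
  have hk : 1 ≤ k := hp.trans hpk
  have e : (1 - k⁻¹) * d = b * (1 + k ^ 2) * (k - 1) := by
    have : k ≠ 0 := by positivity
    rw [hd]; field_simp
  rw [e]
  have h2 : 0 ≤ k ^ 3 * (k ^ 2 - 1) := mul_nonneg (by positivity) (by nlinarith)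
  -- This is the difference of the two sides once `p` is replaced by `2bk`, which is at least `k ≥
  -- p`.
  have h3 : 0 ≤ b * (k ^ 3 * (k ^ 2 - 1) + (k - 1) ^ 2) := by positivity
  nlinarith

theorem scalar_combine_unitary {j q x k' ω v τ δ e : ℝ} (hj : 0 ≤ j) (hq : 0 ≤ q) (hx : 0 ≤ x)
    (hk' : k' ≤ 1) (hp : 1 ≤ p) (hω : ω ≤ j / 2 * (2 * v + τ + 2 * e * q * δ)) (hv : v ≤ q * x)
    (hτ : τ ≤ 2 * (q * (1 - k') / 2) * δ) (he : e ≤ p - 1) (hδ0 : 0 ≤ δ) (hδ : δ ≤ d * x)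
    (hs : 2 + d * (1 - k' + 2 * (p - 1)) ≤ 1 + p * b * k * (1 + k ^ 4)) :
    ω ≤ j * q / 2 * (1 + p * b * k * (1 + k ^ 4)) * x := by
  have h1 : e * (q * δ) ≤ (p - 1) * (q * δ) := mul_le_mul_of_nonneg_right he (by positivity)
  have hc : 0 ≤ q * (1 - k' + 2 * (p - 1)) := mul_nonneg hq (by linarith)
  have h2 := mul_le_mul_of_nonneg_left hδ hc
  have h3 := mul_le_mul_of_nonneg_left hs (mul_nonneg hq hx)
  calc ω ≤ j / 2 * (q * x * (1 + p * b * k * (1 + k ^ 4))) := by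
        refine hω.trans (mul_le_mul_of_nonneg_left (le_trans ?_ h3) (by positivity))
        linarith
    _ = _ := by ring

theorem scalar_combine_circular {q x k' l v τ δ : ℝ} (hp : 0 ≤ p) (hq : 0 ≤ q) (hx : 0 ≤ x)
    (hk' : k' ≤ 1) (hl : l ≤ p / 2 * ((p + p ^ 3) * v + p ^ 2 * τ)) (hv : v ≤ q * x)
    (hτ : τ ≤ 2 * (q * (1 - k') / 2) * δ) (hδ : δ ≤ d * x)
    (hs : p + (1 - k') * d ≤ b * k * (1 + k ^ 4)) :
    l ≤ p * p * q / 2 * (1 + p * b * k * (1 + k ^ 4)) * x := by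
  have h1 : τ ≤ q * (1 - k') * (d * x) := by
    have := mul_le_mul_of_nonneg_left hδ (mul_nonneg hq (sub_nonneg.2 hk'))
    linarith
  calc l ≤ p / 2 * ((p + p ^ 3) * (q * x) + p ^ 2 * (q * (1 - k') * (d * x))) := by
        refine hl.trans ?_
        gcongr
    _ = p * p * q / 2 * (1 + p * (p + (1 - k') * d)) * x := by ring
    _ ≤ p * p * q / 2 * (1 + p * (b * k * (1 + k ^ 4))) * x := by gcongr
    _ = _ := by ring

end ScalarEstimates

/-! ### Bounds for the derivatives of the factors. -/

section DerivativeBounds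

open scoped MatrixOrder ComplexOrder

variable {n : ℕ} {N : Seminorm ℂ (Matrix (Fin n) (Fin n) ℂ)} {Z : Matrix (Fin n) (Fin n) ℂ}

theorem IsUnitarilyInvariantNorm.gram_le (hN : IsUnitarilyInvariantNorm N) (hZ : IsUnit Z)
    (X : Matrix (Fin n) (Fin n) ℂ) : N (Xᴴ * Z + Zᴴ * X) ≤ 2 * ‖Z‖ * N X := by
  have h1 : N (Xᴴ * Z) ≤ N Xᴴ * ‖Z‖ := hN.mul_isUnit_le hZ
  have h2 : N (Zᴴ * X) ≤ ‖Zᴴ‖ * N X := hN.isUnit_mul_le ((Matrix.isUnit_conjTranspose Z).2 hZ)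
  rw [Matrix.l2_opNorm_conjTranspose] at h2
  have h3 := mul_le_mul_of_nonneg_right (hN.conjTranspose_le X) (norm_nonneg Z)
  linarith [map_add_le_add N (Xᴴ * Z) (Zᴴ * X)]

theorem IsUnitarilyInvariantNorm.fderiv_rho2_le [Nonempty (Fin n)]
    (hN : IsUnitarilyInvariantNorm N) (hZ : IsUnit Z) (X : Matrix (Fin n) (Fin n) ℂ) :
    N (fderiv ℝ rho2 Z X) ≤ beta Z * cond Z * (1 + cond Z ^ 2) * N X := by
  have h := isMostowFactorization_rho hZ
  set D := fderiv ℝ rho2 Z X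
  set A' := Xᴴ * Z + Zᴴ * X
  have h1 := hN.le_of_sylvester_posDef (X := D) h.posDef_two (add_comm (rho2 Z * D) _)
  have h2 := hN.le_beta_mul hZ (fderiv_rho2_sylvester hZ X)
  have hC : IsUnit (posSqrt (twistedGram Z)) := by
    rw [posSqrt_twistedGram hZ]
    exact h.posDef_gram.inv.isUnit.mul h.posDef_sq.isUnit
  have hCn : ‖posSqrt (twistedGram Z)‖ ≤ cond Z := by
    rw [posSqrt_twistedGram hZ]; exact h.norm_sqrt_le
  set C := posSqrt (twistedGram Z)
  have hA := hN.gram_le hZ X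
  have h3 : N (Cᴴ * A' * C) ≤ cond Z ^ 2 * N A' := by
    have e1 : N (Cᴴ * A' * C) ≤ N (Cᴴ * A') * ‖C‖ := hN.mul_isUnit_le hC
    have e2 : N (Cᴴ * A') ≤ ‖Cᴴ‖ * N A' := hN.isUnit_mul_le ((Matrix.isUnit_conjTranspose C).2 hC)
    rw [Matrix.l2_opNorm_conjTranspose] at e2
    calc _ ≤ ‖C‖ * N A' * ‖C‖ := e1.trans (mul_le_mul_of_nonneg_right e2 (norm_nonneg C))
      _ ≤ cond Z * N A' * cond Z := by
        have := apply_nonneg N A'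
        have := (norm_nonneg C).trans hCn
        gcongr
      _ = _ := by ring
  have h4 : N (conjMatrix A' + Cᴴ * A' * C) ≤ (1 + cond Z ^ 2) * (2 * ‖Z‖ * N X) := by
    calc _ ≤ N (conjMatrix A') + N (Cᴴ * A' * C) := map_add_le_add _ _ _
      _ ≤ N A' + cond Z ^ 2 * N A' := add_le_add (hN.conjMatrix_le _) h3
      _ = (1 + cond Z ^ 2) * N A' := by ring
      _ ≤ _ := by gcongr
  have hb := beta_nonneg Z
  have hq := h.norm_two_inv_le
  calc N D ≤ ‖(rho2 Z)⁻¹‖ / 2 * (beta Z * ((1 + cond Z ^ 2) * (2 * ‖Z‖ * N X))) := by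
        refine h1.trans (mul_le_mul_of_nonneg_left ?_ (by positivity))
        exact (h2.trans (mul_le_mul_of_nonneg_left h4 hb))
    _ = ‖Z‖ * ‖(rho2 Z)⁻¹‖ * (beta Z * (1 + cond Z ^ 2) * N X) := by ring
    _ ≤ ‖Z‖ * ‖Z⁻¹‖ * (beta Z * (1 + cond Z ^ 2) * N X) := by gcongr
    _ = _ := by rw [cond]; ring

/-- A commutator is unchanged when a scalar is subtracted from `Q`, so only the distance of `Q` to
the scalars matters. -/
theorem IsUnitarilyInvariantNorm.commutator_le (hN : IsUnitarilyInvariantNorm N)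
    {Q : Matrix (Fin n) (Fin n) ℂ} (hQ : Q.IsHermitian) (D : Matrix (Fin n) (Fin n) ℂ) {c r : ℝ}
    (hr : ‖Q - algebraMap ℝ (Matrix (Fin n) (Fin n) ℂ) c‖ ≤ r) :
    N (D * Q - Q * D) ≤ 2 * r * N D := by
  set F := Q - algebraMap ℝ (Matrix (Fin n) (Fin n) ℂ) c with hF
  have hFH : F.IsHermitian :=
    hQ.isSelfAdjoint.sub (IsSelfAdjoint.algebraMap _ (IsSelfAdjoint.all c))
  have e : D * Q - Q * D = D * F - F * D := by
    rw [hF, mul_sub, sub_mul, Algebra.commutes c D]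
    abel
  have h1 : N (D * F) ≤ N D * ‖F‖ := hN.mul_hermitian_le hFH
  have h2 : N (F * D) ≤ ‖F‖ * N D := hN.hermitian_mul_le hFH
  have h3 := mul_le_mul_of_nonneg_right hr (apply_nonneg N D)
  rw [e]
  linarith [map_sub_le_add N (D * F) (F * D)]

/-- The matrix `V = W* X P₂⁻¹`, in terms of which the derivatives of the factors are expressed. -/
theorem fderiv_conjugated_product (hZ : IsUnit Z) (X : Matrix (Fin n) (Fin n) ℂ) :
    (rho0 Z)ᴴ * X * (rho2 Z)⁻¹ = (rho0 Z)ᴴ * fderiv ℝ rho0 Z X * rho1 Z + fderiv ℝ rho1 Z X +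
      rho1 Z * fderiv ℝ rho2 Z X * (rho2 Z)⁻¹ := by
  have h := isMostowFactorization_rho hZ
  have hW : (rho0 Z)ᴴ * rho0 Z = 1 := Matrix.mem_unitaryGroup_iff'.1 h.unitary
  have hu := isUnit_det_of_posDef h.posDef_two
  conv_lhs => rw [fderiv_product hZ X]
  have hWc : ∀ M, (rho0 Z)ᴴ * (rho0 Z * M) = M := fun M => by rw [← mul_assoc, hW, one_mul]
  simp only [mul_add, add_mul, mul_assoc, hWc, Matrix.mul_nonsing_inv _ hu, mul_one]

theorem IsUnitarilyInvariantNorm.conjugated_le (hN : IsUnitarilyInvariantNorm N) (hZ : IsUnit Z)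
    (X : Matrix (Fin n) (Fin n) ℂ) :
    N ((rho0 Z)ᴴ * X * (rho2 Z)⁻¹) ≤ ‖(rho2 Z)⁻¹‖ * N X := by
  have h := isMostowFactorization_rho hZ
  have hW' : (rho0 Z)ᴴ ∈ Matrix.unitaryGroup (Fin n) ℂ := Unitary.star_mem h.unitary
  rw [mul_assoc, hN.unitary_mul hW', mul_comm]
  exact hN.mul_hermitian_le h.posDef_two.inv.isHermitian

/-! ### Bounds for `Ω = W*W'` and `L = P₁'`, with `D = P₂'`, `P = P₁`, `Q = P₂⁻¹`. -/

section AbstractFactors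

variable {Ω V D L P Q : Matrix (Fin n) (Fin n) ℂ}

theorem conjTranspose_factor_sum (hV : V = Ω * P + L + P * D * Q) (hΩ : Ωᴴ = -Ω)
    (hL : L.IsHermitian) (hD : D.IsHermitian) (hP : P.IsHermitian) (hQ : Q.IsHermitian) :
    Vᴴ = -(P * Ω) + L + Q * D * P := by
  rw [hV, Matrix.conjTranspose_add, Matrix.conjTranspose_add, Matrix.conjTranspose_mul,
    Matrix.conjTranspose_mul, Matrix.conjTranspose_mul, hΩ, hP.eq, hL.eq, hD.eq, hQ.eq, mul_neg,
    mul_assoc Q]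

theorem IsUnitarilyInvariantNorm.skew_factor_le [Nonempty (Fin n)]
    (hN : IsUnitarilyInvariantNorm N) (hV : V = Ω * P + L + P * D * Q) (hΩ : Ωᴴ = -Ω)
    (hL : L.IsHermitian) (hD : D.IsHermitian) (hP : P.PosDef) (hQ : Q.IsHermitian) :
    N Ω ≤ ‖P⁻¹‖ / 2 * (2 * N V + N (D * Q - Q * D) + 2 * ‖P - 1‖ * ‖Q‖ * N D) := by
  have hVH := conjTranspose_factor_sum hV hΩ hL hD hP.isHermitian hQ
  have hEH : (P - 1).IsHermitian := hP.isHermitian.sub Matrix.isHermitian_one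
  -- `L` cancels in `V - V*`. Splitting `P = 1 + (P - 1)` in `PDQ - QDP` isolates a commutator,
  -- which is small when `Q` is nearly scalar.
  have key : P * Ω + Ω * P = V - Vᴴ - (D * Q - Q * D) - (P - 1) * D * Q + Q * (D * (P - 1)) := by
    rw [hVH, hV]
    noncomm_ring
  refine (hN.le_of_sylvester_posDef hP key).trans (mul_le_mul_of_nonneg_left ?_ (by positivity))
  have t1 : N ((P - 1) * D * Q) ≤ ‖P - 1‖ * N D * ‖Q‖ :=
    (hN.mul_hermitian_le hQ).trans
      (mul_le_mul_of_nonneg_right (hN.hermitian_mul_le hEH) (norm_nonneg Q))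
  have t2 : N (Q * (D * (P - 1))) ≤ ‖Q‖ * (N D * ‖P - 1‖) :=
    (hN.hermitian_mul_le hQ).trans
      (mul_le_mul_of_nonneg_left (hN.mul_hermitian_le hEH) (norm_nonneg Q))
  have hVHle := hN.conjTranspose_le V
  have s1 := map_add_le_add N (V - Vᴴ - (D * Q - Q * D) - (P - 1) * D * Q) (Q * (D * (P - 1)))
  have s2 := map_sub_le_add N (V - Vᴴ - (D * Q - Q * D)) ((P - 1) * D * Q)
  have s3 := map_sub_le_add N (V - Vᴴ) (D * Q - Q * D)
  have s4 := map_sub_le_add N V Vᴴ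
  linarith

/-- `PV + V*P = PL + LP + P²DQ + QDP²`, free of `Ω`. Conjugation replaces `P` by `P⁻¹` and `L` by
`-P⁻¹LP⁻¹`; multiplying that version by `P²` on both sides and subtracting doubles `PL + LP` and
leaves `D`, `Q` only through their commutator. -/
theorem circular_factor_identity (hV : V = Ω * P + L + P * D * Q) (hΩ : Ωᴴ = -Ω)
    (hL : L.IsHermitian) (hD : D.IsHermitian) (hP : P.PosDef) (hQ : Q.IsHermitian)
    (hPc : conjMatrix P = P⁻¹) (hLc : conjMatrix L * P + P⁻¹ * L = 0) (hDc : conjMatrix D = D)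
    (hQc : conjMatrix Q = Q) :
    (2 : ℝ) • (P * L + L * P) = P * V + Vᴴ * P - P * conjMatrix V * (P * P) -
      P * P * (conjMatrix V)ᴴ * P - P * P * (D * Q - Q * D) + (D * Q - Q * D) * (P * P) := by
  have hu := isUnit_det_of_posDef hP
  have hJ1 : P * P⁻¹ = 1 := Matrix.mul_nonsing_inv _ hu
  have hJ2 : P⁻¹ * P = 1 := Matrix.nonsing_inv_mul _ hu
  have hJ := hP.inv.isHermitian
  generalize P⁻¹ = J at *
  have hJ1c : ∀ M, P * (J * M) = M := fun M => by rw [← mul_assoc, hJ1, one_mul]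
  have hJ2c : ∀ M, J * (P * M) = M := fun M => by rw [← mul_assoc, hJ2, one_mul]
  have hLc' : conjMatrix L = -(J * L * J) := by
    have := congrArg (· * J) (eq_neg_of_add_eq_zero_left hLc)
    simpa only [mul_assoc, hJ1, mul_one, neg_mul] using this
  have hO : (conjMatrix Ω)ᴴ = -conjMatrix Ω := by
    have e : (conjMatrix Ω)ᴴ = conjMatrix Ωᴴ := rfl
    rw [e, hΩ]
    exact map_neg (conjCLM n) Ω
  have hVc : conjMatrix V = conjMatrix Ω * J + -(J * L * J) + J * D * Q := by
    have e : conjMatrix V = conjMatrix (Ω * P) + conjMatrix L + conjMatrix (P * D * Q) := by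
      rw [hV]
      exact (map_add (conjCLM n) _ _).trans (congrArg (· + _) (map_add (conjCLM n) _ _))
    rw [e, conjMatrix_mul, conjMatrix_mul, conjMatrix_mul, hPc, hDc, hQc, hLc']
  have hJLJ : (-(J * L * J)).IsHermitian := by
    refine Matrix.IsHermitian.neg ?_
    rw [Matrix.IsHermitian, Matrix.conjTranspose_mul, Matrix.conjTranspose_mul, hJ.eq, hL.eq,
      mul_assoc]
  rw [conjTranspose_factor_sum hV hΩ hL hD hP.isHermitian hQ,
    conjTranspose_factor_sum hVc hO hJLJ hD hJ hQ, hVc, hV, two_smul]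
  simp only [mul_add, add_mul, mul_sub, sub_mul, mul_neg, neg_mul, mul_assoc, hJ1c, hJ2c, hJ2,
    mul_one]
  abel

theorem IsUnitarilyInvariantNorm.circular_factor_le [Nonempty (Fin n)]
    (hN : IsUnitarilyInvariantNorm N) (hV : V = Ω * P + L + P * D * Q) (hΩ : Ωᴴ = -Ω)
    (hL : L.IsHermitian) (hD : D.IsHermitian) (hP : P.PosDef) (hQ : Q.IsHermitian)
    (hPc : conjMatrix P = P⁻¹) (hLc : conjMatrix L * P + P⁻¹ * L = 0) (hDc : conjMatrix D = D)
    (hQc : conjMatrix Q = Q) :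
    N L ≤ ‖P⁻¹‖ / 2 * ((‖P‖ + ‖P‖ ^ 3) * N V + ‖P‖ ^ 2 * N (D * Q - Q * D)) := by
  have key := circular_factor_identity hV hΩ hL hD hP hQ hPc hLc hDc hQc
  refine (hN.le_of_sylvester_posDef hP rfl).trans (mul_le_mul_of_nonneg_left ?_ (by positivity))
  have hV'le : N (conjMatrix V) ≤ N V := hN.conjMatrix_le V
  generalize conjMatrix V = V' at *
  generalize D * Q - Q * D = T at *
  have m1 : ∀ M, N (P * M) ≤ ‖P‖ * N M := fun M => hN.hermitian_mul_le hP.isHermitian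
  have m2 : ∀ M, N (M * P) ≤ N M * ‖P‖ := fun M => hN.mul_hermitian_le hP.isHermitian
  have hp0 := norm_nonneg P
  have b1 := m1 V
  have b2 := (m2 Vᴴ).trans (mul_le_mul_of_nonneg_right (hN.conjTranspose_le V) hp0)
  have b3 : N (P * V' * (P * P)) ≤ ‖P‖ * N V * ‖P‖ * ‖P‖ := by
    rw [← mul_assoc]
    refine (m2 _).trans (mul_le_mul_of_nonneg_right ?_ hp0)
    refine (m2 _).trans (mul_le_mul_of_nonneg_right ?_ hp0)
    exact (m1 _).trans (mul_le_mul_of_nonneg_left hV'le hp0)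
  have b4 : N (P * P * V'ᴴ * P) ≤ ‖P‖ * (‖P‖ * N V) * ‖P‖ := by
    refine (m2 _).trans (mul_le_mul_of_nonneg_right ?_ hp0)
    rw [mul_assoc]
    refine (m1 _).trans (mul_le_mul_of_nonneg_left ?_ hp0)
    exact (m1 _).trans (mul_le_mul_of_nonneg_left ((hN.conjTranspose_le V').trans hV'le) hp0)
  have b5 : N (P * P * T) ≤ ‖P‖ * (‖P‖ * N T) := by
    rw [mul_assoc]
    exact (m1 _).trans (mul_le_mul_of_nonneg_left (m1 _) hp0)
  have b6 : N (T * (P * P)) ≤ N T * ‖P‖ * ‖P‖ := by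
    rw [← mul_assoc]
    exact (m2 _).trans (mul_le_mul_of_nonneg_right (m2 _) hp0)
  have hnk := seminorm_smul_real (N := N) (X := P * L + L * P) 2 (by norm_num)
  rw [key] at hnk
  have s1 := map_add_le_add N (P * V + Vᴴ * P - P * V' * (P * P) - P * P * V'ᴴ * P - P * P * T)
    (T * (P * P))
  have s2 := map_sub_le_add N (P * V + Vᴴ * P - P * V' * (P * P) - P * P * V'ᴴ * P) (P * P * T)
  have s3 := map_sub_le_add N (P * V + Vᴴ * P - P * V' * (P * P)) (P * P * V'ᴴ * P)
  have s4 := map_sub_le_add N (P * V + Vᴴ * P) (P * V' * (P * P))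
  have s5 := map_add_le_add N (P * V) (Vᴴ * P)
  linarith

end AbstractFactors

theorem conjTranspose_rho0_mul_fderiv (hZ : IsUnit Z) (X : Matrix (Fin n) (Fin n) ℂ) :
    ((rho0 Z)ᴴ * fderiv ℝ rho0 Z X)ᴴ = -((rho0 Z)ᴴ * fderiv ℝ rho0 Z X) := by
  rw [Matrix.conjTranspose_mul, Matrix.conjTranspose_conjTranspose]
  exact eq_neg_of_add_eq_zero_left (fderiv_rho0_skew hZ X)

theorem IsUnitarilyInvariantNorm.fderiv_rho0_le [Nonempty (Fin n)]
    (hN : IsUnitarilyInvariantNorm N) (hZ : IsUnit Z) (X : Matrix (Fin n) (Fin n) ℂ) :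
    N (fderiv ℝ rho0 Z X) ≤ ‖(rho1 Z)⁻¹‖ * ‖(rho2 Z)⁻¹‖ / 2 *
      (1 + ‖rho1 Z‖ * beta Z * cond Z * (1 + cond Z ^ 4)) * N X := by
  have h := isMostowFactorization_rho hZ
  have hQ := h.posDef_two.inv.isHermitian
  obtain ⟨c, hc⟩ := h.exists_norm_two_inv_sub_le
  have hW' : (rho0 Z)ᴴ ∈ Matrix.unitaryGroup (Fin n) ℂ := Unitary.star_mem h.unitary
  have hS := hN.skew_factor_le (fderiv_conjugated_product hZ X)
    (conjTranspose_rho0_mul_fderiv hZ X) (fderiv_rho1_isHermitian hZ X)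
    (fderiv_rho2_isHermitian hZ X) h.posDef_one hQ
  rw [hN.unitary_mul hW'] at hS
  exact scalar_combine_unitary (norm_nonneg _) (norm_nonneg _) (apply_nonneg N X)
    (inv_le_one_of_one_le₀ (h.one_le_norm_one.trans h.norm_one_le)) h.one_le_norm_one hS
    (hN.conjugated_le hZ X) (hN.commutator_le hQ _ hc) h.norm_one_sub_one_le (apply_nonneg N _)
    (hN.fderiv_rho2_le hZ X)
    (scalar_bound_unitary h.one_le_norm_one h.norm_one_le (half_le_beta hZ) rfl)

theorem IsUnitarilyInvariantNorm.fderiv_rho1_le [Nonempty (Fin n)]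
    (hN : IsUnitarilyInvariantNorm N) (hZ : IsUnit Z) (X : Matrix (Fin n) (Fin n) ℂ) :
    N (fderiv ℝ rho1 Z X) ≤ cond (rho1 Z) * ‖(rho2 Z)⁻¹‖ / 2 *
      (1 + ‖rho1 Z‖ * beta Z * cond Z * (1 + cond Z ^ 4)) * N X := by
  have h := isMostowFactorization_rho hZ
  have hQ := h.posDef_two.inv.isHermitian
  obtain ⟨c, hc⟩ := h.exists_norm_two_inv_sub_le
  have hS := hN.circular_factor_le (fderiv_conjugated_product hZ X)
    (conjTranspose_rho0_mul_fderiv hZ X) (fderiv_rho1_isHermitian hZ X)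
    (fderiv_rho2_isHermitian hZ X) h.posDef_one hQ h.circular (fderiv_rho1_circular hZ X)
    (fderiv_rho2_real hZ X) (by rw [conjMatrix_inv, h.real])
  rw [cond]
  rw [h.norm_one_inv] at hS ⊢
  exact scalar_combine_circular (norm_nonneg _) (norm_nonneg _) (apply_nonneg N X)
    (inv_le_one_of_one_le₀ (h.one_le_norm_one.trans h.norm_one_le)) hS
    (hN.conjugated_le hZ X) (hN.commutator_le hQ _ hc) (hN.fderiv_rho2_le hZ X)
    (scalar_bound_circular h.one_le_norm_one h.norm_one_le (half_le_beta hZ) rfl)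

theorem cond_nonneg (Z : Matrix (Fin n) (Fin n) ℂ) : 0 ≤ cond Z := by
  rw [cond]; positivity

theorem inducedNorm_le {T : Matrix (Fin n) (Fin n) ℂ →L[ℝ] Matrix (Fin n) (Fin n) ℂ} {c : ℝ}
    (hc : 0 ≤ c) (h : Nonempty (Fin n) → ∀ X, N (T X) ≤ c * N X) : inducedNorm N T ≤ c := by
  -- For `n = 0` no `X` has norm one, and the supremum of the empty set is `0`; hence `c` must be
  -- nonnegative.
  refine Real.sSup_le ?_ hc
  rintro r ⟨X, hX, rfl⟩
  have hn : Nonempty (Fin n) := by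
    by_contra hn
    rw [not_nonempty_iff] at hn
    rw [Subsingleton.elim X 0, map_zero] at hX
    exact zero_ne_one hX
  simpa [hX] using h hn X

end DerivativeBounds

end Mostow

theorem theorem3p1 {n : ℕ} (Z : Matrix (Fin n) (Fin n) ℂ) (hZ : IsUnit Z) :
    -- the decomposition and the square root in `β(Z)` exist and are unique, `β(Z)` converges
    (∃! p : Matrix (Fin n) (Fin n) ℂ × Matrix (Fin n) (Fin n) ℝ × Matrix (Fin n) (Fin n) ℝ,
      Mostow.IsMostow Z p.1 p.2.1 p.2.2) ∧
    (∃! C : Matrix (Fin n) (Fin n) ℂ, Mostow.IsPosSqrt (Mostow.twistedGram Z) C) ∧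
    MeasureTheory.IntegrableOn (Mostow.betaIntegrand Z) (Set.Ioi (0 : ℝ)) ∧
    -- the factor maps are (real) differentiable at `Z`
    DifferentiableAt ℝ Mostow.rho0 Z ∧
    DifferentiableAt ℝ Mostow.rho1 Z ∧
    DifferentiableAt ℝ Mostow.rho2 Z ∧
    -- the bounds, for every unitarily invariant norm
    ∀ N : Seminorm ℂ (Matrix (Fin n) (Fin n) ℂ), Mostow.IsUnitarilyInvariantNorm N →
      Mostow.inducedNorm N (fderiv ℝ Mostow.rho0 Z) ≤
          ‖(Mostow.rho1 Z)⁻¹‖ * ‖(Mostow.rho2 Z)⁻¹‖ / 2 *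
            (1 + ‖Mostow.rho1 Z‖ * Mostow.beta Z * Mostow.cond Z * (1 + Mostow.cond Z ^ 4)) ∧
      Mostow.inducedNorm N (fderiv ℝ Mostow.rho1 Z) ≤
          Mostow.cond (Mostow.rho1 Z) * ‖(Mostow.rho2 Z)⁻¹‖ / 2 *
            (1 + ‖Mostow.rho1 Z‖ * Mostow.beta Z * Mostow.cond Z * (1 + Mostow.cond Z ^ 4)) ∧
      Mostow.inducedNorm N (fderiv ℝ Mostow.rho2 Z) ≤
          Mostow.beta Z * Mostow.cond Z * (1 + Mostow.cond Z ^ 4) := by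
  refine ⟨Mostow.existsUnique_isMostow hZ, Mostow.existsUnique_isPosSqrt hZ,
    Mostow.integrableOn_betaIntegrand hZ, Mostow.differentiableAt_rho0 hZ,
    Mostow.differentiableAt_rho1 hZ, Mostow.differentiableAt_rho2 hZ, fun N hN => ?_⟩
  have hb := Mostow.beta_nonneg Z
  have hk := Mostow.cond_nonneg Z
  have hk1 := Mostow.cond_nonneg (Mostow.rho1 Z)
  refine ⟨Mostow.inducedNorm_le (by positivity) fun hn X => hN.fderiv_rho0_le hZ X,
    Mostow.inducedNorm_le (by positivity) fun hn X => hN.fderiv_rho1_le hZ X,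
    Mostow.inducedNorm_le (by positivity) fun hn X => ?_⟩
  -- It remains to weaken `k²` to `k⁴`, using `1 ≤ ‖P₁‖ ≤ k`.
  refine (hN.fderiv_rho2_le hZ X).trans ?_
  have h := Mostow.isMostowFactorization_rho hZ
  have h1 := h.one_le_norm_one.trans h.norm_one_le
  gcongr
  · norm_num
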